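/- **Setting.** *Type theory.* Work in Martin-Löf type theory with a cumulative hierarchy $\mathsf{Set}_k$ (write $\mathsf{Set}=\mathsf{Set}_0$), $\Pi$- and $\Sigma$-types, contexts of fresh typed variables $x:S$ and definitions $x\mapsto t:S$, and a typed judgmental equality: the congruence generated by $\beta$, the two projections of a pair, unfolding of definitions, and the equations of the functions below. It contains: a unit type $1$ with element $*$; tags $'t:\mathsf{UId}$; enumerations $\mathsf{EnumU}$ (lists of tags), their index types $\mathsf{EnumT}\,E$, the lookup-tuple type $\pi\,E\,P$ and the eliminator $\pi\,E\,P\to(x:\mathsf{EnumT}\,E)\to P\,x$; a propositional equality $a\equiv b:\mathsf{Set}$ with its eliminator; and, for an index type $I:\mathsf{Set}_1$, the universe $\mathsf{IDesc}\,I:\mathsf{Set}_1$ with codes $\mathsf{var}\,i$, $1$, $A\times B$, $\Pi\,S\,T$, $\Sigma\,S\,T$ ($S:\mathsf{Set}$, $T:S\to\mathsf{IDesc}\,I$) and $\sigma\,E\,T$ ($E:\mathsf{EnumU}$, $T:\mathsf{EnumT}\,E\to\mathsf{IDesc}\,I$), the interpretation $[\![D]\!]:(I\to\mathsf{Set})\to\mathsf{Set}$,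 the fixpoint $\mathsf{IMu}:(I\to\mathsf{IDesc}\,I)\to I\to\mathsf{Set}$ with constructor $\mathsf{in}$, and its induction principle. Write $\Gamma\vdash\mathsf{VALID}$, $\Gamma\vdash t:T$ and $\Gamma\vdash s\equiv t:T$ for validity, typing and equality. An external language of named terms is related to it by a bidirectional type checker; $\Gamma\vdash T\ni t\rightsquigarrow t'$ means that the external term $t$ is checked against $T$ and elaborates to $t'$ (the checker also elaborates tuples, finite sets $\{\vec l\}$ and functions $\{\vec l\mapsto\vec e\}$ out of them, tags, and datatype constructors). *Labels.* A label $l$ is a name $\mathbf D$ followed by parameters $\langle p\rangle$, indices $[i]$ and constrained indices $\langle i=t\rangle$, where $p$ and $i$ are internal terms and $t$ is an external one. Its index type $[\![l]\!]$ and index tuple $\mathrm{ix}(l)$ are given by $[\![\mathbf D]\!]=1$, $[\![l\langle p\rangle]\!]=[\![l]\!]$, $[\![l[i]]\!]=[\![l\langle i=t\rangle]\!]=\Sigma_{x:[\![l]\!]}F$, and $\mathrm{ix}(\mathbf D)=*$, $\mathrm{ix}(l\langle p\rangle)=\mathrm{ix}(l)$, $\mathrm{ix}(l[i])=\mathrm{ix}(l\langle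 i=t\rangle)=(\mathrm{ix}(l),i)$. Here $F$ is the type of the index $i$, which may depend on the preceding indices (so $[\![l]\!]\times I$ if it is a type $I$ that does not). A label is well formed if each $p$ has a type and each $F$ is a family in $\mathsf{Set}_1$ over $[\![l]\!]$ with $i:F[\mathrm{ix}(l)/x]$. A well-formed label gives a type $\langle l\rangle:\mathsf{Set}_1$; if $E:\mathsf{EnumU}$ and $T:\mathsf{EnumT}\,E\to\mathsf{IDesc}\,[\![l]\!]$ then $\mathsf{return}\,E\,T:\langle l\rangle$; if $t:\langle l\rangle$ then $\mathsf{call}\,\langle l\rangle\,t:\mathsf{IDesc}\,[\![l]\!]$; and $\mathsf{call}\,\langle l\rangle(\mathsf{return}\,E\,T)\equiv\sigma\,E\,T$. *Elaboration.* Let an arbitrary relation "elimination with a motive" $\Gamma\vdash e\rightsquigarrow e':T$ be given, which is assumed to be sound: it implies $\Gamma\vdash e':T$. Elaboration consists of the following relations. 1. *Extraction of indices.* A recursive occurrence (the external application of $D$ to parameters and indices) is matched with a label. On $\mathbf D$ the result is $*$. A parameter must elaborate, up to judgmental equality, to the label's parameter. If $is$ has been extracted so far, then at an index, constrained or not, the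 user's index is checked against $F[is/x]$, elaborates to some $i$, and the result becomes $(is,i)$. 2. *Constraints.* A label yields a code $q$: $\mathbf D$ gives $1$; parameters and unconstrained indices are skipped; for $l\langle i=t\rangle$, where $i:I\in\Gamma$ is a variable and $\Gamma\vdash I\ni t\rightsquigarrow t'$, one gets $\Sigma\,(i\equiv t')\,\lambda\_.q$ from the code $q$ of $l$. 3. *Arguments against* $\langle l\rangle$. The argument telescope $(x:T)\,\Delta$ gives $\Sigma\,T'\,\lambda x.c$ if $\Gamma\vdash\mathsf{Set}\ni T\rightsquigarrow T'$ and $\Delta$ gives $c$ in $\Gamma,x:T'$; it gives $(\mathsf{var}\,is)\times c$ if $T$ is a recursive occurrence with indices $is$ and $\Delta$ gives $c$ in $\Gamma$; $(f:(x:T)\to\nabla)\,\Delta$ gives $(\Pi\,T'\,\lambda x.c)\times d$, where $\nabla$ gives $c$ in $\Gamma,x:T'$ and $\Delta$ gives $d$ in $\Gamma$; the empty telescope gives the constraint code of $l$. A constructor gives its tag and the code of its arguments; a choice of constructors gives the list of these. 4. *Pattern validation.* A pattern is the name $D$ applied to external terms and constraints $\langle i=t\rangle$. It is matched entry by entry with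 a label: a term must elaborate, up to judgmental equality, to the label's parameter or index, which is kept; a constraint $\langle i=t\rangle$ turns an entry $[i]$, with $i$ a variable, into $\langle i=t\rangle$, and leaves an entry $\langle i=t\rangle$ unchanged. 5. *Pattern choices against* $\langle l\rangle$. Choices are a list of clauses $pt_j\ni cs_j$, possibly followed by $pt\Leftarrow e\,\{\vec p_k\}$, where the $p_k$ are again pattern choices. The pattern $pt_j$ turns $l$ into a label $l_j$, and $cs_j$ is elaborated against $\langle l_j\rangle$, giving tags and codes $c\mapsto a$. Without the final part, the result is $\mathsf{return}\,\{\vec c\}\,\{\vec c\mapsto\vec a\}$. With it, if $pt$ turns $l$ into $l'$, if $\Gamma\vdash e\rightsquigarrow e':\overrightarrow{((\vec x_k:\vec X_k)\to\langle l_k\rangle)}\to\langle l'\rangle$, and if each $p_k$ elaborates against $\langle l_k\rangle$ in $\Gamma,\vec x_k:\vec X_k$ to $\mathrm{code}_k$, the result is the same with one more branch, $'\mathsf{elim}\mapsto\mathsf{call}\,\langle l'\rangle\,(e'\,\overrightarrow{(\lambda\vec x_k.\,\mathrm{code}_k)})$. 6. *Definitions.* Let $D\notin\Gamma$, let $\Gamma\vdash\mathsf{Set}_1\ni(\vec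 p:\vec P)(\vec i:\vec I)\to\mathsf{Set}\rightsquigarrow(\vec p:\vec P')(\vec i:\vec I')\to\mathsf{Set}$, and let $\mathrm{choices}$ elaborate, in $\Gamma;\vec p:\vec P';\vec i:\vec I'$ and against the label $l=\mathbf D\,\overrightarrow{\langle p\rangle}\,\overrightarrow{[i]}$, to $\mathrm{code}$. Then the definition of $D$ with parameters $\vec p:\vec P$, indices $\vec i:\vec I$ and these choices elaborates in $\Gamma$ to the extended context $$\Delta=\Gamma\,[\,D\mapsto\lambda\vec p:\vec P'.\,\lambda\vec i:\vec I'.\;\mathsf{IMu}\,\bigl(\lambda\vec i:\vec I'.\,\mathsf{call}\,\langle l\rangle\,\mathrm{code}\bigr)\,\vec i\;:\;(\vec p:\vec P')(\vec i:\vec I')\to\mathsf{Set}\,],$$ where $\mathsf{IMu}$, at index type $[\![l]\!]$, is applied to the uncurried function and to the tuple $\mathrm{ix}(l)$. **Theorem (soundness of elaboration).** If the definition of $D$ with parameters $\vec p:\vec P$, indices $\vec i:\vec I$ and pattern choices $\mathrm{choices}$ elaborates in $\Gamma$ to the context $\Delta$, then $\Delta\vdash\mathsf{VALID}$. (In particular,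 the defined term, built from the generated code and its fixpoint, has the stated type.) -/

import Mathlib

namespace IndFam

/-! # The internal language -/

/-- Names of the external language. -/
abbrev Name := ℕ

/-- Constructor labels. The label `elim` is the one reserved for computation over indices. -/
inductive Tag
  | user (x : Name)
  | elim

/-- The constants of the type theory: unit type, tags and enumerations with their eliminator,
propositional equality, and the universe of indexed descriptions with its fixpoint and
induction principle. A constant that works at every universe level carries that level. -/
inductive Const
  | unit | void
  | uid | tag (t : Tag)
  | enumU | nilE | consE | enumT | zeroE | sucE
  | spi (k : ℕ) | enumElim (k : ℕ)
  | eq (k : ℕ) | refl (k : ℕ) | eqElim (k j : ℕ)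
  | idesc | dvar | dunit | dtimes | dpi | dsigma | denum
  | interp | imu | inn
  | iall (k : ℕ) | iallMap (k : ℕ) | iind (k : ℕ)

/-- Terms of the external language; variables are named. -/
inductive ETerm
  | var (x : Name)
  | set (k : ℕ)
  | const (c : Const)
  | pi (x : Name) (A B : ETerm)
  | sig (x : Name) (A B : ETerm)
  | lam (x : Name) (t : ETerm)
  | app (f s : ETerm)
  | fst (t : ETerm)
  | snd (t : ETerm)
  | ann (t T : ETerm)
  /-- The empty tuple `()`. -/
  | tnil
  /-- The tuple `(t ts)`. -/
  | tcons (t ts : ETerm)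
  /-- The finite set `{l₀, …, lₖ}`. -/
  | enum (ts : List Tag)
  /-- The function `{l₀ ↦ e₀, …, lₖ ↦ eₖ}` out of a finite set. -/
  | cases (bs : List (Tag × ETerm))
  | tag (t : Tag)
  /-- The constructor of the fixpoint, `in t`. -/
  | inn (t : ETerm)
  /-- A datatype constructor applied to arguments, `c a₀ … aₖ`. -/
  | ctor (c : Tag) (as : List ETerm)

mutual
/-- Terms of the internal language, with de Bruijn indices. -/
inductive Term
  | var (n : ℕ)
  | set (k : ℕ)
  | pi (A B : Term)
  | lam (A t : Term)
  | app (f s : Term)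
  | sig (A B : Term)
  /-- The pair `(s, t)`, annotated by the family `B` of the type of `t` over the type of `s`. -/
  | pair (B s t : Term)
  | fst (t : Term)
  | snd (t : Term)
  | const (c : Const)
  /-- The type `⟨l⟩`. -/
  | desc (l : Label)
  /-- `return E T`, of type `⟨l⟩`. -/
  | ret (E T : Term)
  /-- `call ⟨l⟩ t`. -/
  | call (l : Label) (t : Term)
/-- Description labels: a datatype name followed by parameters, indices and constrained indices.
A parameter `p` is annotated by its type `P`. An index `i` is annotated by its type `F`, a family
over the product of the types of the preceding indices: `F` binds one variable. The right-hand
side `t` of a constraint is a term of the external language, since it may mention variables that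
only come into scope with the arguments of a constructor. -/
inductive Label
  | name (D : Name)
  | param (l : Label) (P p : Term)
  | index (l : Label) (F i : Term)
  | constr (l : Label) (F i : Term) (t : ETerm)
end

/-- A renaming under a binder. -/
def liftR (ρ : ℕ → ℕ) : ℕ → ℕ
  | 0 => 0
  | n + 1 => ρ n + 1

mutual
def Term.rename : (ℕ → ℕ) → Term → Term
  | ρ, .var n => .var (ρ n)
  | _, .set k => .set k
  | ρ, .pi A B => .pi (A.rename ρ) (B.rename (liftR ρ))
  | ρ, .lam A t => .lam (A.rename ρ) (t.rename (liftR ρ))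
  | ρ, .app f s => .app (f.rename ρ) (s.rename ρ)
  | ρ, .sig A B => .sig (A.rename ρ) (B.rename (liftR ρ))
  | ρ, .pair B s t => .pair (B.rename (liftR ρ)) (s.rename ρ) (t.rename ρ)
  | ρ, .fst t => .fst (t.rename ρ)
  | ρ, .snd t => .snd (t.rename ρ)
  | _, .const c => .const c
  | ρ, .desc l => .desc (l.rename ρ)
  | ρ, .ret E T => .ret (E.rename ρ) (T.rename ρ)
  | ρ, .call l t => .call (l.rename ρ) (t.rename ρ)
def Label.rename : (ℕ → ℕ) → Label → Label
  | _, .name D => .name D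
  | ρ, .param l P p => .param (l.rename ρ) (P.rename ρ) (p.rename ρ)
  | ρ, .index l F i => .index (l.rename ρ) (F.rename (liftR ρ)) (i.rename ρ)
  | ρ, .constr l F i t => .constr (l.rename ρ) (F.rename (liftR ρ)) (i.rename ρ) t
end

/-- Shift all free variables by `n`. -/
def Term.shift (n : ℕ) (t : Term) : Term := t.rename (fun m => m + n)

/-- Weakening by one variable. -/
def Term.wk (t : Term) : Term := t.rename Nat.succ

def Label.wk (l : Label) : Label := l.rename Nat.succ

/-- A substitution under a binder. -/
def liftS (σ : ℕ → Term) : ℕ → Term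
  | 0 => .var 0
  | n + 1 => (σ n).wk

mutual
def Term.subst : (ℕ → Term) → Term → Term
  | σ, .var n => σ n
  | _, .set k => .set k
  | σ, .pi A B => .pi (A.subst σ) (B.subst (liftS σ))
  | σ, .lam A t => .lam (A.subst σ) (t.subst (liftS σ))
  | σ, .app f s => .app (f.subst σ) (s.subst σ)
  | σ, .sig A B => .sig (A.subst σ) (B.subst (liftS σ))
  | σ, .pair B s t => .pair (B.subst (liftS σ)) (s.subst σ) (t.subst σ)
  | σ, .fst t => .fst (t.subst σ)
  | σ, .snd t => .snd (t.subst σ)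
  | _, .const c => .const c
  | σ, .desc l => .desc (l.subst σ)
  | σ, .ret E T => .ret (E.subst σ) (T.subst σ)
  | σ, .call l t => .call (l.subst σ) (t.subst σ)
def Label.subst : (ℕ → Term) → Label → Label
  | _, .name D => .name D
  | σ, .param l P p => .param (l.subst σ) (P.subst σ) (p.subst σ)
  | σ, .index l F i => .index (l.subst σ) (F.subst (liftS σ)) (i.subst σ)
  | σ, .constr l F i t => .constr (l.subst σ) (F.subst (liftS σ)) (i.subst σ) t
end

/-- `t[s/x]` for the outermost variable `x` of `t`. -/
def Term.inst (t s : Term) : Term :=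
  t.subst (fun n => match n with
    | 0 => s
    | m + 1 => .var m)

/-! Abbreviations for applied constants. -/

namespace Term

/-- The non-dependent function type. -/
abbrev arr (A B : Term) : Term := pi A B.wk
abbrev app2 (f a b : Term) : Term := app (app f a) b
abbrev app3 (f a b c : Term) : Term := app (app2 f a b) c
abbrev app4 (f a b c d : Term) : Term := app (app3 f a b c) d
abbrev app5 (f a b c d e : Term) : Term := app (app4 f a b c d) e
abbrev app6 (f a b c d e g : Term) : Term := app (app5 f a b c d e) g

abbrev unit : Term := const .unit
abbrev void : Term := const .void
abbrev uid : Term := const .uid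
abbrev tag (t : Tag) : Term := const (.tag t)
abbrev enumU : Term := const .enumU
abbrev nilE : Term := const .nilE
abbrev consE (t E : Term) : Term := app2 (const .consE) t E
abbrev enumT (E : Term) : Term := app (const .enumT) E
abbrev zeroE (t E : Term) : Term := app2 (const .zeroE) t E
abbrev sucE (t E n : Term) : Term := app3 (const .sucE) t E n
abbrev spi (k : ℕ) (E P : Term) : Term := app2 (const (.spi k)) E P
/-- `enumElim E P es`, a function on `EnumT E`. -/
abbrev enumElim (k : ℕ) (E P es : Term) : Term := app3 (const (.enumElim k)) E P es
abbrev eq (k : ℕ) (A a b : Term) : Term := app3 (const (.eq k)) A a b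
abbrev refl (k : ℕ) (A a : Term) : Term := app2 (const (.refl k)) A a
abbrev eqElim (k j : ℕ) (A a P p b q : Term) : Term := app6 (const (.eqElim k j)) A a P p b q
abbrev idesc (I : Term) : Term := app (const .idesc) I
abbrev dvar (I i : Term) : Term := app2 (const .dvar) I i
abbrev dunit (I : Term) : Term := app (const .dunit) I
abbrev dtimes (I A B : Term) : Term := app3 (const .dtimes) I A B
abbrev dpi (I S T : Term) : Term := app3 (const .dpi) I S T
abbrev dsigma (I S T : Term) : Term := app3 (const .dsigma) I S T
abbrev denum (I E T : Term) : Term := app3 (const .denum) I E T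
abbrev interp (I D X : Term) : Term := app3 (const .interp) I D X
/-- `IMu R`, a family over `I`. -/
abbrev imu (I R : Term) : Term := app2 (const .imu) I R
abbrev inn (I R i xs : Term) : Term := app4 (const .inn) I R i xs
abbrev iall (k : ℕ) (I D X xs P : Term) : Term := app5 (const (.iall k)) I D X xs P
abbrev iallMap (k : ℕ) (I D X P p xs : Term) : Term := app6 (const (.iallMap k)) I D X P p xs
/-- `iind R P m`, a function on indices and elements of the fixpoint. -/
abbrev iind (k : ℕ) (I R P m : Term) : Term := app4 (const (.iind k)) I R P m

end Term

open Term in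
/-- The types of the constants (closed terms). -/
def constType : Const → Term
  | .unit => set 0
  | .void => unit
  | .uid => set 0
  | .tag _ => uid
  | .enumU => set 0
  | .nilE => enumU
  | .consE => arr uid (arr enumU enumU)
  | .enumT => arr enumU (set 0)
  | .zeroE => pi uid (pi enumU (enumT (consE (var 1) (var 0))))
  | .sucE => pi uid (pi enumU (arr (enumT (var 0)) (enumT (consE (var 1) (var 0)))))
  -- `(E : EnumU) (P : EnumT E → Set k) → Set k`
  | .spi k => pi enumU (arr (arr (enumT (var 0)) (set k)) (set k))
  -- `(E : EnumU) (P : EnumT E → Set k) → π E P → (x : EnumT E) → P x`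
  | .enumElim k =>
      pi enumU (pi (arr (enumT (var 0)) (set k))
        (arr (spi k (var 1) (var 0)) (pi (enumT (var 1)) (app (var 1) (var 0)))))
  | .eq k => pi (set k) (arr (var 0) (arr (var 0) (set 0)))
  | .refl k => pi (set k) (pi (var 0) (eq k (var 1) (var 0) (var 0)))
  -- `(A : Set k) (a : A) (P : (b : A) → a ≡ b → Set j) → P a refl → (b : A) (q : a ≡ b) → P b q`
  | .eqElim k j =>
      pi (set k) (pi (var 0)
        (pi (pi (var 1) (arr (eq k (var 2) (var 1) (var 0)) (set j)))
          (arr (app2 (var 0) (var 1) (refl k (var 2) (var 1)))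
            (pi (var 2) (pi (eq k (var 3) (var 2) (var 0)) (app2 (var 2) (var 1) (var 0)))))))
  | .idesc => arr (set 1) (set 1)
  | .dvar => pi (set 1) (arr (var 0) (idesc (var 0)))
  | .dunit => pi (set 1) (idesc (var 0))
  | .dtimes => pi (set 1) (arr (idesc (var 0)) (arr (idesc (var 0)) (idesc (var 0))))
  | .dpi => pi (set 1) (pi (set 0) (arr (arr (var 0) (idesc (var 1))) (idesc (var 1))))
  | .dsigma => pi (set 1) (pi (set 0) (arr (arr (var 0) (idesc (var 1))) (idesc (var 1))))
  | .denum => pi (set 1) (pi enumU (arr (arr (enumT (var 0)) (idesc (var 1))) (idesc (var 1))))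
  -- `(I : Set 1) → IDesc I → (I → Set) → Set`
  | .interp => pi (set 1) (arr (idesc (var 0)) (arr (arr (var 0) (set 0)) (set 0)))
  -- `(I : Set 1) → (I → IDesc I) → I → Set`
  | .imu => pi (set 1) (arr (arr (var 0) (idesc (var 0))) (arr (var 0) (set 0)))
  -- `(I : Set 1) (R : I → IDesc I) (i : I) → ⟦R i⟧ (IMu R) → IMu R i`
  | .inn =>
      pi (set 1) (pi (arr (var 0) (idesc (var 0))) (pi (var 1)
        (arr (interp (var 2) (app (var 1) (var 0)) (imu (var 2) (var 1)))
          (app (imu (var 2) (var 1)) (var 0)))))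
  -- `(I : Set 1) (D : IDesc I) (X : I → Set) (xs : ⟦D⟧ X) → ((i : I) × X i → Set k) → Set k`
  | .iall k =>
      pi (set 1) (pi (idesc (var 0)) (pi (arr (var 1) (set 0))
        (pi (interp (var 2) (var 1) (var 0))
          (arr (arr (sig (var 3) (app (var 2) (var 0))) (set k)) (set k)))))
  -- `(I : Set 1) (D : IDesc I) (X : I → Set) (P : (i : I) × X i → Set k) →
  --    ((i : I) (x : X i) → P (i, x)) → (xs : ⟦D⟧ X) → IAll D X xs P`
  | .iallMap k =>
      pi (set 1) (pi (idesc (var 0)) (pi (arr (var 1) (set 0))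
        (pi (arr (sig (var 2) (app (var 1) (var 0))) (set k))
          (arr (pi (var 3) (pi (app (var 2) (var 0))
              (app (var 2) (pair (app (var 4) (var 0)) (var 1) (var 0)))))
            (pi (interp (var 3) (var 2) (var 1))
              (iall k (var 4) (var 3) (var 2) (var 0) (var 1)))))))
  -- `(I : Set 1) (R : I → IDesc I) (P : (i : I) × IMu R i → Set k) →
  --    ((i : I) (xs : ⟦R i⟧ (IMu R)) → IAll (R i) (IMu R) xs P → P (i, in xs)) →
  --    (i : I) (x : IMu R i) → P (i, x)`
  | .iind k =>
      pi (set 1) (pi (arr (var 0) (idesc (var 0)))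
        (pi (arr (sig (var 1) (app (imu (var 2) (var 1)) (var 0))) (set k))
          (arr
            (pi (var 2) (pi (interp (var 3) (app (var 2) (var 0)) (imu (var 3) (var 2)))
              (arr (iall k (var 4) (app (var 3) (var 1)) (imu (var 4) (var 3)) (var 0) (var 2))
                (app (var 2) (pair (app (imu (var 5) (var 4)) (var 0)) (var 1)
                  (inn (var 4) (var 3) (var 1) (var 0)))))))
            (pi (var 2) (pi (app (imu (var 3) (var 2)) (var 0))
              (app (var 2) (pair (app (imu (var 5) (var 4)) (var 0)) (var 1) (var 0))))))))

open Term in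
/-- The index type computed from a label: the (left-nested) product of the types of its indices,
constrained or not. -/
def Label.ty : Label → Term
  | .name _ => unit
  | .param l _ _ => l.ty
  | .index l F _ => sig l.ty F
  | .constr l F _ _ => sig l.ty F

open Term in
/-- The tuple of the indices at which a label stands. -/
def Label.ix : Label → Term
  | .name _ => void
  | .param l _ _ => l.ix
  | .index l F i => pair F l.ix i
  | .constr l F i _ => pair F l.ix i

open Term in
/-- The defining equations of the functions that compute over enumerations, equality proofs,
descriptions, fixpoints and labels. -/
inductive Comp : Term → Term → Prop
  | spi_nil (k P) : Comp (spi k nilE P) unit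
  | spi_cons (k t E P) : Comp (spi k (consE t E) P)
      (sig (app P (zeroE t E))
        (spi k E (lam (enumT E) (app P.wk (sucE t.wk E.wk (var 0))))).wk)
  | enumElim_zero (k t E P es) :
      Comp (app (enumElim k (consE t E) P es) (zeroE t E)) (fst es)
  | enumElim_suc (k t E P es n) :
      Comp (app (enumElim k (consE t E) P es) (sucE t E n))
        (app (enumElim k E (lam (enumT E) (app P.wk (sucE t.wk E.wk (var 0)))) (snd es)) n)
  | eqElim_refl (k j A a P p) : Comp (eqElim k j A a P p a (refl k A a)) p
  | interp_var (I i X) : Comp (interp I (dvar I i) X) (app X i)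
  | interp_unit (I X) : Comp (interp I (dunit I) X) unit
  | interp_times (I A B X) : Comp (interp I (dtimes I A B) X)
      (sig (interp I A X) (interp I B X).wk)
  | interp_pi (I S T X) : Comp (interp I (dpi I S T) X)
      (pi S (interp I.wk (app T.wk (var 0)) X.wk))
  | interp_sigma (I S T X) : Comp (interp I (dsigma I S T) X)
      (sig S (interp I.wk (app T.wk (var 0)) X.wk))
  | interp_enum (I E T X) : Comp (interp I (denum I E T) X)
      (sig (enumT E) (interp I.wk (app T.wk (var 0)) X.wk))
  | iall_var (k I i X xs P) : Comp (iall k I (dvar I i) X xs P)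
      (app P (pair (app X.wk (var 0)) i xs))
  | iall_unit (k I X xs P) : Comp (iall k I (dunit I) X xs P) unit
  | iall_times (k I A B X xs P) : Comp (iall k I (dtimes I A B) X xs P)
      (sig (iall k I A X (fst xs) P) (iall k I B X (snd xs) P).wk)
  | iall_pi (k I S T X xs P) : Comp (iall k I (dpi I S T) X xs P)
      (pi S (iall k I.wk (app T.wk (var 0)) X.wk (app xs.wk (var 0)) P.wk))
  | iall_sigma (k I S T X xs P) : Comp (iall k I (dsigma I S T) X xs P)
      (iall k I (app T (fst xs)) X (snd xs) P)
  | iall_enum (k I E T X xs P) : Comp (iall k I (denum I E T) X xs P)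
      (iall k I (app T (fst xs)) X (snd xs) P)
  | iallMap_var (k I i X P p xs) : Comp (iallMap k I (dvar I i) X P p xs) (app2 p i xs)
  | iallMap_unit (k I X P p xs) : Comp (iallMap k I (dunit I) X P p xs) void
  | iallMap_times (k I A B X P p xs) : Comp (iallMap k I (dtimes I A B) X P p xs)
      (pair (iall k I B X (snd xs) P).wk
        (iallMap k I A X P p (fst xs)) (iallMap k I B X P p (snd xs)))
  | iallMap_pi (k I S T X P p xs) : Comp (iallMap k I (dpi I S T) X P p xs)
      (lam S (iallMap k I.wk (app T.wk (var 0)) X.wk P.wk p.wk (app xs.wk (var 0))))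
  | iallMap_sigma (k I S T X P p xs) : Comp (iallMap k I (dsigma I S T) X P p xs)
      (iallMap k I (app T (fst xs)) X P p (snd xs))
  | iallMap_enum (k I E T X P p xs) : Comp (iallMap k I (denum I E T) X P p xs)
      (iallMap k I (app T (fst xs)) X P p (snd xs))
  | iind_inn (k I R P m i xs) : Comp (app2 (iind k I R P m) i (inn I R i xs))
      (app3 m i xs (iallMap k I (app R i) (imu I R) P (iind k I R P m) xs))
  | call_ret (l E T) : Comp (call l (ret E T)) (denum l.ty E T)

/-- An entry of a context: a typed variable, or a definition with its type. -/
inductive Entry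
  | decl (A : Term)
  | defn (t A : Term)

def Entry.ty : Entry → Term
  | .decl A => A
  | .defn _ A => A

/-- Contexts, the most recent entry first. -/
abbrev Ctx := List Entry

/-- The judgement forms of the type theory. -/
inductive Jdg
  /-- `Γ` is a valid context. -/
  | valid (Γ : Ctx)
  /-- `Γ ⊢ t : T`. -/
  | type (Γ : Ctx) (t T : Term)
  /-- `Γ ⊢ s ≡ t : T`. -/
  | eq (Γ : Ctx) (s t T : Term)
  /-- `Γ ⊢ l idatatel`: the label `l` is well formed. -/
  | tel (Γ : Ctx) (l : Label)
  /-- The labels `l` and `l'` are judgmentally equal. -/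
  | telEq (Γ : Ctx) (l l' : Label)

open Term in
/-- Derivability in the type theory. -/
inductive Der : Jdg → Prop
  -- Context validity
  | valid_nil : Der (.valid [])
  | valid_decl {Γ A k} : Der (.valid Γ) → Der (.type Γ A (set k)) → Der (.valid (.decl A :: Γ))
  | valid_defn {Γ t A k} : Der (.valid Γ) → Der (.type Γ A (set k)) → Der (.type Γ t A) →
      Der (.valid (.defn t A :: Γ))
  -- Typing
  | var {Γ n e} : Der (.valid Γ) → Γ[n]? = some e → Der (.type Γ (var n) (e.ty.shift (n + 1)))
  | set {Γ} (k) : Der (.valid Γ) → Der (.type Γ (set k) (set (k + 1)))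
  | const {Γ} (c : Const) : Der (.valid Γ) → Der (.type Γ (const c) (constType c))
  | pi {Γ A B k} : Der (.type Γ A (set k)) → Der (.type (.decl A :: Γ) B (set k)) →
      Der (.type Γ (pi A B) (set k))
  | lam {Γ A B t k} : Der (.type Γ A (set k)) → Der (.type (.decl A :: Γ) t B) →
      Der (.type Γ (lam A t) (pi A B))
  | app {Γ A B f s} : Der (.type Γ f (pi A B)) → Der (.type Γ s A) →
      Der (.type Γ (app f s) (B.inst s))
  | sig {Γ A B k} : Der (.type Γ A (set k)) → Der (.type (.decl A :: Γ) B (set k)) →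
      Der (.type Γ (sig A B) (set k))
  | pair {Γ A B s t k} : Der (.type Γ s A) → Der (.type (.decl A :: Γ) B (set k)) →
      Der (.type Γ t (B.inst s)) → Der (.type Γ (pair B s t) (sig A B))
  | fst {Γ A B t} : Der (.type Γ t (sig A B)) → Der (.type Γ (fst t) A)
  | snd {Γ A B t} : Der (.type Γ t (sig A B)) → Der (.type Γ (snd t) (B.inst (fst t)))
  | desc {Γ l} : Der (.tel Γ l) → Der (.type Γ (desc l) (set 1))
  | ret {Γ l E T} : Der (.tel Γ l) → Der (.type Γ E enumU) →
      Der (.type Γ T (arr (enumT E) (idesc l.ty))) → Der (.type Γ (ret E T) (desc l))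
  | call {Γ l t} : Der (.tel Γ l) → Der (.type Γ t (desc l)) →
      Der (.type Γ (call l t) (idesc l.ty))
  | cumul {Γ A j k} : Der (.type Γ A (set j)) → j ≤ k → Der (.type Γ A (set k))
  | conv {Γ t A B k} : Der (.type Γ t A) → Der (.eq Γ A B (set k)) → Der (.type Γ B (set k)) →
      Der (.type Γ t B)
  -- Labels
  | tel_name {Γ} (D) : Der (.valid Γ) → Der (.tel Γ (.name D))
  | tel_param {Γ l P p k} : Der (.tel Γ l) → Der (.type Γ P (set k)) → Der (.type Γ p P) →
      Der (.tel Γ (.param l P p))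
  | tel_index {Γ l F i} : Der (.tel Γ l) → Der (.type (.decl l.ty :: Γ) F (set 1)) →
      Der (.type Γ i (F.inst l.ix)) → Der (.tel Γ (.index l F i))
  | tel_constr {Γ l F i} (t) : Der (.tel Γ l) → Der (.type (.decl l.ty :: Γ) F (set 1)) →
      Der (.type Γ i (F.inst l.ix)) → Der (.tel Γ (.constr l F i t))
  -- Judgmental equality: computation
  | beta {Γ A B s t k} : Der (.type Γ A (set k)) → Der (.type (.decl A :: Γ) t B) →
      Der (.type Γ s A) → Der (.eq Γ (app (lam A t) s) (t.inst s) (B.inst s))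
  | fst_pair {Γ A B s t k} : Der (.type Γ s A) → Der (.type (.decl A :: Γ) B (set k)) →
      Der (.type Γ t (B.inst s)) → Der (.eq Γ (fst (pair B s t)) s A)
  | snd_pair {Γ A B s t k} : Der (.type Γ s A) → Der (.type (.decl A :: Γ) B (set k)) →
      Der (.type Γ t (B.inst s)) → Der (.eq Γ (snd (pair B s t)) t (B.inst s))
  | delta {Γ n t A} : Der (.valid Γ) → Γ[n]? = some (.defn t A) →
      Der (.eq Γ (var n) (t.shift (n + 1)) (A.shift (n + 1)))
  | comp {Γ s t A} : Comp s t → Der (.type Γ s A) → Der (.type Γ t A) → Der (.eq Γ s t A)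
  -- Judgmental equality: equivalence, conversion, cumulativity
  | eq_refl {Γ t A} : Der (.type Γ t A) → Der (.eq Γ t t A)
  | eq_symm {Γ s t A} : Der (.eq Γ s t A) → Der (.eq Γ t s A)
  | eq_trans {Γ s t u A} : Der (.eq Γ s t A) → Der (.eq Γ t u A) → Der (.eq Γ s u A)
  | eq_conv {Γ s t A B k} : Der (.eq Γ s t A) → Der (.eq Γ A B (set k)) →
      Der (.type Γ B (set k)) → Der (.eq Γ s t B)
  | eq_cumul {Γ A B j k} : Der (.eq Γ A B (set j)) → j ≤ k → Der (.eq Γ A B (set k))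
  -- Judgmental equality: congruence
  | eq_pi {Γ A A' B B' k} : Der (.type Γ A (set k)) → Der (.eq Γ A A' (set k)) →
      Der (.eq (.decl A :: Γ) B B' (set k)) → Der (.eq Γ (pi A B) (pi A' B') (set k))
  | eq_lam {Γ A A' B t t' k} : Der (.type Γ A (set k)) → Der (.eq Γ A A' (set k)) →
      Der (.eq (.decl A :: Γ) t t' B) → Der (.eq Γ (lam A t) (lam A' t') (pi A B))
  | eq_app {Γ A B f f' s s'} : Der (.eq Γ f f' (pi A B)) → Der (.eq Γ s s' A) →
      Der (.eq Γ (app f s) (app f' s') (B.inst s))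
  | eq_sig {Γ A A' B B' k} : Der (.type Γ A (set k)) → Der (.eq Γ A A' (set k)) →
      Der (.eq (.decl A :: Γ) B B' (set k)) → Der (.eq Γ (sig A B) (sig A' B') (set k))
  | eq_pair {Γ A B B' s s' t t' k} : Der (.type Γ A (set k)) →
      Der (.type (.decl A :: Γ) B (set k)) → Der (.eq (.decl A :: Γ) B B' (set k)) →
      Der (.eq Γ s s' A) → Der (.eq Γ t t' (B.inst s)) →
      Der (.eq Γ (pair B s t) (pair B' s' t') (sig A B))
  | eq_fst {Γ A B t t'} : Der (.eq Γ t t' (sig A B)) → Der (.eq Γ (fst t) (fst t') A)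
  | eq_snd {Γ A B t t'} : Der (.eq Γ t t' (sig A B)) →
      Der (.eq Γ (snd t) (snd t') (B.inst (fst t)))
  | eq_desc {Γ l l'} : Der (.telEq Γ l l') → Der (.eq Γ (desc l) (desc l') (set 1))
  | eq_ret {Γ l E E' T T'} : Der (.tel Γ l) → Der (.eq Γ E E' enumU) →
      Der (.eq Γ T T' (arr (enumT E) (idesc l.ty))) → Der (.eq Γ (ret E T) (ret E' T') (desc l))
  | eq_call {Γ l l' t t'} : Der (.telEq Γ l l') → Der (.eq Γ t t' (desc l)) →
      Der (.eq Γ (call l t) (call l' t') (idesc l.ty))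
  | telEq_name {Γ} (D) : Der (.valid Γ) → Der (.telEq Γ (.name D) (.name D))
  | telEq_param {Γ l l' P P' p p' k} : Der (.telEq Γ l l') → Der (.eq Γ P P' (set k)) →
      Der (.eq Γ p p' P) → Der (.telEq Γ (.param l P p) (.param l' P' p'))
  | telEq_index {Γ l l' F F' i i'} : Der (.tel Γ l) → Der (.telEq Γ l l') →
      Der (.type (.decl l.ty :: Γ) F (set 1)) → Der (.eq (.decl l.ty :: Γ) F F' (set 1)) →
      Der (.eq Γ i i' (F.inst l.ix)) → Der (.telEq Γ (.index l F i) (.index l' F' i'))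
  | telEq_constr {Γ l l' F F' i i'} (t) : Der (.tel Γ l) → Der (.telEq Γ l l') →
      Der (.type (.decl l.ty :: Γ) F (set 1)) → Der (.eq (.decl l.ty :: Γ) F F' (set 1)) →
      Der (.eq Γ i i' (F.inst l.ix)) → Der (.telEq Γ (.constr l F i t) (.constr l' F' i' t))

/-- `Γ ⊢ t : T`. -/
abbrev HasType (Γ : Ctx) (t T : Term) : Prop := Der (.type Γ t T)

/-- `Γ ⊢ s ≡ t : T`. -/
abbrev EqType (Γ : Ctx) (s t T : Term) : Prop := Der (.eq Γ s t T)

/-! # Named contexts and the bidirectional type checker -/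

/-- Contexts whose entries are named. -/
abbrev NCtx := List (Name × Entry)

def NCtx.core (Γ : NCtx) : Ctx := Γ.map Prod.snd

def NCtx.names (Γ : NCtx) : List Name := Γ.map Prod.fst

/-- Validity of a named context: every name is fresh for the entries before it, every type is a
type, and every definition has its type. -/
def NCtx.Valid (Γ : NCtx) : Prop := Γ.names.Nodup ∧ Der (.valid Γ.core)

/-- Extend a context by a telescope of named variables, outermost first. -/
def NCtx.extend : NCtx → List Name → List Term → NCtx
  | Γ, x :: xs, A :: As => NCtx.extend ((x, .decl A) :: Γ) xs As
  | Γ, _, _ => Γ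

/-- The two directions of the bidirectional type checker. -/
inductive Dir
  | infer
  | check

/-- The tuple `(t₀ … tₖ)`. -/
def tupleE : List ETerm → ETerm
  | [] => .tnil
  | t :: ts => .tcons t (tupleE ts)

open Term in
/-- The bidirectional type checker. `Bidir .infer Γ t t' T`: in the context `Γ` the external term
`t` elaborates to the internal term `t'` and its type `T` is synthesized. `Bidir .check Γ t t' T`:
in the context `Γ` the external term `t` is checked against the type `T` and elaborates to the
internal term `t'`. -/
inductive Bidir : Dir → NCtx → ETerm → Term → Term → Prop
  -- Synthesis
  | var {Γ x n e} : Γ.Valid → Γ[n]? = some (x, e) →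
      Bidir .infer Γ (.var x) (var n) (e.ty.shift (n + 1))
  | set {Γ} (k) : Γ.Valid → Bidir .infer Γ (.set k) (set k) (set (k + 1))
  | const {Γ} (c : Const) : Γ.Valid → Bidir .infer Γ (.const c) (const c) (constType c)
  | app {Γ f f' s s' A B} : Bidir .infer Γ f f' (pi A B) → Bidir .check Γ s s' A →
      Bidir .infer Γ (.app f s) (app f' s') (B.inst s')
  | fst {Γ t t' A B} : Bidir .infer Γ t t' (sig A B) → Bidir .infer Γ (.fst t) (fst t') A
  | snd {Γ t t' A B} : Bidir .infer Γ t t' (sig A B) →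
      Bidir .infer Γ (.snd t) (snd t') (B.inst (fst t'))
  | ann {Γ t t' T T' k} : Bidir .check Γ T T' (set k) → Bidir .check Γ t t' T' →
      Bidir .infer Γ (.ann t T) t' T'
  | infer_conv {Γ t t' A B k} : Bidir .infer Γ t t' A → EqType Γ.core A B (set k) →
      HasType Γ.core B (set k) → Bidir .infer Γ t t' B
  -- Checking
  | switch {Γ t t' A} : Bidir .infer Γ t t' A → Bidir .check Γ t t' A
  | cumul {Γ A A' j k} : Bidir .infer Γ A A' (set j) → j ≤ k → Bidir .check Γ A A' (set k)
  | check_conv {Γ t t' A B k} : Bidir .check Γ t t' A → EqType Γ.core A B (set k) →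
      HasType Γ.core A (set k) → HasType Γ.core B (set k) → Bidir .check Γ t t' B
  | pi {Γ x A A' B B' k} : Bidir .check Γ A A' (set k) →
      Bidir .check ((x, .decl A') :: Γ) B B' (set k) →
      Bidir .check Γ (.pi x A B) (pi A' B') (set k)
  | sig {Γ x A A' B B' k} : Bidir .check Γ A A' (set k) →
      Bidir .check ((x, .decl A') :: Γ) B B' (set k) →
      Bidir .check Γ (.sig x A B) (sig A' B') (set k)
  | lam {Γ x t t' A B} : Bidir .check ((x, .decl A) :: Γ) t t' B →
      Bidir .check Γ (.lam x t) (lam A t') (pi A B)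
  -- Tuples
  | tnil {Γ} : Γ.Valid → Bidir .check Γ .tnil void unit
  | tcons {Γ t t' ts ts' A B} : Bidir .check Γ t t' A → Bidir .check Γ ts ts' (B.inst t') →
      Bidir .check Γ (.tcons t ts) (pair B t' ts') (sig A B)
  -- Finite sets
  | enum_nil {Γ} : Γ.Valid → Bidir .check Γ (.enum []) nilE enumU
  | enum_cons {Γ a ts E} : Bidir .check Γ (.enum ts) E enumU →
      Bidir .check Γ (.enum (a :: ts)) (consE (tag a) E) enumU
  | cases {Γ bs E P es k} : Bidir .check Γ (.enum (bs.map Prod.fst)) E enumU →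
      HasType Γ.core P (arr (enumT E) (set k)) →
      Bidir .check Γ (tupleE (bs.map Prod.snd)) es (spi k E P) →
      Bidir .check Γ (.cases bs) (enumElim k E P es) (pi (enumT E) (app P.wk (var 0)))
  -- Tags, and indexing into a finite set by a tag
  | tag_uid {Γ} (a) : Γ.Valid → Bidir .check Γ (.tag a) (tag a) uid
  | tag_zero {Γ E} (a) : Γ.Valid → HasType Γ.core E enumU →
      Bidir .check Γ (.tag a) (zeroE (tag a) E) (enumT (consE (tag a) E))
  | tag_suc {Γ E n a} (b) : HasType Γ.core E enumU → Bidir .check Γ (.tag a) n (enumT E) →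
      Bidir .check Γ (.tag a) (sucE (tag b) E n) (enumT (consE (tag b) E))
  -- Datatype constructors
  | inn {Γ t t' I R i} : HasType Γ.core I (set 1) → HasType Γ.core R (arr I (idesc I)) →
      HasType Γ.core i I → Bidir .check Γ t t' (interp I (app R i) (imu I R)) →
      Bidir .check Γ (.inn t) (inn I R i t') (app (imu I R) i)
  | ctor {Γ c as t' I R i E T} : EqType Γ.core (app R i) (denum I E T) (idesc I) →
      Bidir .check Γ (.inn (tupleE (.tag c :: as))) t' (app (imu I R) i) →
      Bidir .check Γ (.ctor c as) t' (app (imu I R) i)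

/-- `Γ ⊢ T ∋ t ⇝ t'`. -/
abbrev Check (Γ : NCtx) (t : ETerm) (t' T : Term) : Prop := Bidir .check Γ t t' T

/-- The external term `e`, checked against the type `T`, denotes the internal term `t`. -/
def Matches (Γ : NCtx) (e : ETerm) (t T : Term) : Prop :=
  ∃ t', Check Γ e t' T ∧ EqType Γ.core t' t T

/-! # The syntax of inductive definitions -/

/-- Telescopes of constructor arguments: `ε`, `(x : T) Δ` and `(f : (x : T) → ∇) Δ`. -/
inductive Args
  | nil
  | arg (x : Name) (T : ETerm) (rest : Args)
  | fn (f x : Name) (T : ETerm) (nabla rest : Args)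

/-- A constructor with its arguments. -/
structure Constr where
  name : Tag
  args : Args

/-- Datatype patterns: the datatype name applied to terms `t` and constraints `⟨x = t⟩`. -/
inductive Pat
  | name (D : Name)
  | app (T : Pat) (t : ETerm)
  | constr (T : Pat) (x : Name) (t : ETerm)

/-- Pattern choices: clauses `pt ∋ c₀ | … | cₙ`, possibly followed by a computation over the
indices `pt ⇐ e { p₀ … pₘ }` whose branches are again pattern choices. -/
inductive Patts
  | clauses (cs : List (Pat × List Constr))
  | elimBy (cs : List (Pat × List Constr)) (pt : Pat) (e : ETerm) (branches : List Patts)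

/-! # Elaboration of inductive families -/

open Term in
/-- Extraction of indices: `Γ ⊢ l ∋ T ⇝ is`. -/
inductive ElabRecArgs : NCtx → Label → ETerm → Term → Prop
  | name {Γ} (D) : Γ.Valid → ElabRecArgs Γ (.name D) (.var D) void
  | param {Γ l P p T e is} : ElabRecArgs Γ l T is → Matches Γ e p P →
      ElabRecArgs Γ (.param l P p) (.app T e) is
  | index {Γ l F i' T e i is} : ElabRecArgs Γ l T is → Check Γ e i (F.inst is) →
      ElabRecArgs Γ (.index l F i') (.app T e) (pair F is i)
  | constr {Γ l F i' t T e i is} : ElabRecArgs Γ l T is → Check Γ e i (F.inst is) →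
      ElabRecArgs Γ (.constr l F i' t) (.app T e) (pair F is i)

open Term in
/-- Elaboration of constraints: `Γ ⊢ l ⇝ q`, where `q` is a description over the index type `J`. -/
inductive ElabEqs : NCtx → Term → Label → Term → Prop
  | name {Γ J} (D) : Γ.Valid → ElabEqs Γ J (.name D) (dunit J)
  | param {Γ J l P p q} : ElabEqs Γ J l q → ElabEqs Γ J (.param l P p) q
  | index {Γ J l F i q} : ElabEqs Γ J l q → ElabEqs Γ J (.index l F i) q
  | constr {Γ J l F n e k t t' q} : ElabEqs Γ J l q → Γ.core[n]? = some e →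
      HasType Γ.core (e.ty.shift (n + 1)) (set k) → Check Γ t t' (e.ty.shift (n + 1)) →
      ElabEqs Γ J (.constr l F (var n) t)
        (dsigma J (eq k (e.ty.shift (n + 1)) (var n) t')
          (lam (eq k (e.ty.shift (n + 1)) (var n) t') q.wk))

open Term in
/-- Elaboration of arguments: `Γ ⊢ ⟨l⟩ ∋ args ⇝ code`. -/
inductive ElabArgs : NCtx → Label → Args → Term → Prop
  | arg {Γ l x T T' Δ c} : Check Γ T T' (set 0) → ElabArgs ((x, .decl T') :: Γ) l.wk Δ c →
      ElabArgs Γ l (.arg x T Δ) (dsigma l.ty T' (lam T' c))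
  | recur {Γ l x T is Δ c} : ElabRecArgs Γ l T is → ElabArgs Γ l Δ c →
      ElabArgs Γ l (.arg x T Δ) (dtimes l.ty (dvar l.ty is) c)
  | fn {Γ l f x T T' nabla Δ c d} : Check Γ T T' (set 0) →
      ElabArgs ((x, .decl T') :: Γ) l.wk nabla c → ElabArgs Γ l Δ d →
      ElabArgs Γ l (.fn f x T nabla Δ) (dtimes l.ty (dpi l.ty T' (lam T' c)) d)
  | nil {Γ l q} : ElabEqs Γ l.ty l q → ElabArgs Γ l .nil q

/-- Elaboration of a constructor to a label and a code. -/
inductive ElabConstr : NCtx → Label → Constr → Term × Term → Prop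
  | mk {Γ l c c' args code} : Check Γ (.tag c) c' Term.uid → ElabArgs Γ l args code →
      ElabConstr Γ l ⟨c, args⟩ (c', code)

/-- Elaboration of a choice of constructors to the list of their labels and codes. -/
def ElabChoices (Γ : NCtx) (l : Label) (cs : List Constr) (out : List (Term × Term)) : Prop :=
  List.Forall₂ (ElabConstr Γ l) cs out

/-- Pattern validation: the pattern `T` fits the label `l` and interprets to the label `l'`. -/
inductive ElabIndices : NCtx → Label → Pat → Label → Prop
  | name {Γ} (D) : ElabIndices Γ (.name D) (.name D) (.name D)
  | param {Γ l T l' P p e} : ElabIndices Γ l T l' → Matches Γ e p P →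
      ElabIndices Γ (.param l P p) (.app T e) (.param l' P p)
  | index {Γ l T l' F i e} : ElabIndices Γ l T l' → Matches Γ e i (F.inst l.ix) →
      ElabIndices Γ (.index l F i) (.app T e) (.index l' F i)
  | constr {Γ l T l' F n x t} : ElabIndices Γ l T l' → Γ.names[n]? = some x →
      ElabIndices Γ (.index l F (.var n)) (.constr T x t) (.constr l' F (.var n) t)
  | constr_again {Γ l T l' F n x t} : ElabIndices Γ l T l' → Γ.names[n]? = some x →
      ElabIndices Γ (.constr l F (.var n) t) (.constr T x t) (.constr l' F (.var n) t)

/-- Elaboration of the clauses of a pattern choice; the labels and codes of all the constructors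
are collected. -/
inductive ElabClauses : NCtx → Label → List (Pat × List Constr) → List (Term × Term) → Prop
  | nil {Γ l} : ElabClauses Γ l [] []
  | cons {Γ l pt l' cs out rest outs} : ElabIndices Γ l pt l' → ElabChoices Γ l' cs out →
      ElabClauses Γ l rest outs → ElabClauses Γ l ((pt, cs) :: rest) (out ++ outs)

/-- The enumeration `{t₀, …, tₖ}`. -/
def enumOf : List (Term × Term) → Term
  | [] => .nilE
  | o :: os => .consE o.1 (enumOf os)

/-- The constant family `λ _. IDesc I` over `EnumT E`. -/
def descFam (I E : Term) : Term := .lam (.enumT E) (Term.idesc I).wk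

/-- The lookup tuple of the codes, in `π {t₀, …, tₖ} (λ _. IDesc I)`. -/
def codeTuple (I : Term) : List (Term × Term) → Term
  | [] => .void
  | o :: os => .pair (Term.spi 1 (enumOf os) (descFam I (enumOf os))).wk o.2 (codeTuple I os)

/-- The function `{t₀ ↦ code₀, …, tₖ ↦ codeₖ}` in `EnumT {t₀, …, tₖ} → IDesc I`. -/
def casesOf (I : Term) (os : List (Term × Term)) : Term :=
  .enumElim 1 (enumOf os) (descFam I (enumOf os)) (codeTuple I os)

/-- `(x₀ : A₀) … (xₙ : Aₙ) → B`. -/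
def piTel (As : List Term) (B : Term) : Term := As.foldr .pi B

/-- `λ (x₀ : A₀) … (xₙ : Aₙ). t`. -/
def lamTel (As : List Term) (t : Term) : Term := As.foldr .lam t

/-- `f a₀ … aₙ`. -/
def apps (f : Term) (as : List Term) : Term := as.foldl .app f

/-- A branch of a computation over indices: the telescope of variables that it binds, the label
that it is elaborated against, its pattern choices and the code they elaborate to. -/
structure Branch where
  names : List Name
  tel : List Term
  label : Label
  patts : Patts
  code : Term

/-- The type `((x⃗₀ : X⃗₀) → ⟨l₀⟩) → … → ((x⃗ₖ : X⃗ₖ) → ⟨lₖ⟩) → ⟨l⟩` of an elimination. -/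
def elimTy (bs : List Branch) (l : Label) : Term :=
  bs.foldr (fun b T => Term.arr (piTel b.tel (.desc b.label)) T) (.desc l)

/-- Elaboration of pattern choices: `Γ ⊢ ⟨l⟩ ∋ patts ⇝ code`. The relation `EWM Γ e e' T` is
elimination with a motive: the elimination form `e` elaborates to the term `e'` of type `T`. -/
inductive ElabPatts (EWM : NCtx → ETerm → Term → Term → Prop) :
    NCtx → Label → Patts → Term → Prop
  | clauses {Γ l cs outs} : ElabClauses Γ l cs outs →
      ElabPatts EWM Γ l (.clauses cs) (.ret (enumOf outs) (casesOf l.ty outs))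
  | elimBy {Γ l cs outs pt l' e e' os} (bs : List Branch) : ElabClauses Γ l cs outs →
      ElabIndices Γ l pt l' → EWM Γ e e' (elimTy bs l') →
      (∀ b ∈ bs, b.names.length = b.tel.length) →
      (∀ b ∈ bs, ElabPatts EWM (Γ.extend b.names b.tel) b.label b.patts b.code) →
      os = outs ++
        [(.tag .elim, .call l' (apps e' (bs.map fun b => lamTel b.tel b.code)))] →
      ElabPatts EWM Γ l (.elimBy cs pt e (bs.map Branch.patts))
        (.ret (enumOf os) (casesOf l.ty os))

/-! ## The definition of the datatype -/

/-- The `m`-th last component of a left-nested tuple `t`. -/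
def proj (t : Term) : ℕ → Term
  | 0 => .snd t
  | m + 1 => proj (.fst t) m

/-- Extend the label `l` by the parameters bound by a telescope. -/
def paramLabel : List Term → Label → Label
  | [], l => l
  | P :: Ps, l => paramLabel Ps (.param l.wk P.wk (.var 0))

/-- Extend the label `l` by the indices bound by a telescope, `n` indices being there already. In
the type of an index, the preceding indices are replaced by the projections of their tuple. -/
def indexLabel : ℕ → List Term → Label → Label
  | _, [], l => l
  | n, I :: Is, l => indexLabel (n + 1) Is
      (.index l.wk
        ((I.subst fun m => if m < n then proj (.var 0) m else .var (m + 1)).rename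
          (liftR Nat.succ))
        (.var 0))

/-- The label `D [p⃗] [i⃗]` in the context extended by the parameters and the indices. -/
def dataLabel (D : Name) (Ps Is : List Term) : Label :=
  indexLabel 0 Is (paramLabel Ps (.name D))

/-- The product of the index types, in the context extended by the parameters; `n` indices, of
product `T`, have been dealt with. -/
def indexProd : ℕ → List Term → Term → Term
  | _, [], T => T
  | n, I :: Is, T => indexProd (n + 1) Is
      (.sig T (I.subst fun m => if m < n then proj (.var 0) m else .var (m - n + 1)))

/-- The uncurried form, on the product `J` of index types, of a function of `n` indices. -/
def uncurry (J : Term) (n : ℕ) (f : Term) : Term :=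
  .lam J (apps f.wk ((List.range n).reverse.map (proj (.var 0))))

/-- `λ p⃗ i⃗. IMu (λ i⃗. call ⟨D [p⃗] [i⃗]⟩ code) i⃗`, where `IMu` takes the uncurried function and
the tuple of indices. -/
def dataTerm (D : Name) (Ps Is : List Term) (code : Term) : Term :=
  let l := dataLabel D Ps Is
  let J := indexProd 0 Is .unit
  let R := uncurry J Is.length (lamTel Is (.call l code))
  lamTel Ps (lamTel Is
    (.app (.imu (J.shift Is.length) (R.shift Is.length)) l.ix))

/-- The external function type `(x₀ : A₀) … (xₙ : Aₙ) → B`. -/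
def piTelE (As : List (Name × ETerm)) (B : ETerm) : ETerm :=
  As.foldr (fun a T => .pi a.1 a.2 T) B

/-- Elaboration of an inductive definition: in the context `Γ`, the definition of the datatype `D`
with parameters `ps`, indices `is` and pattern choices `choices` elaborates to the extended
context. -/
inductive ElabIData (EWM : NCtx → ETerm → Term → Term → Prop) :
    NCtx → Name → List (Name × ETerm) → List (Name × ETerm) → Patts → NCtx → Prop
  | mk {Γ D ps is choices Ps Is code} : D ∉ Γ.names →
      Ps.length = ps.length → Is.length = is.length →
      Check Γ (piTelE (ps ++ is) (.set 0)) (piTel (Ps ++ Is) (.set 0)) (.set 1) →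
      ElabPatts EWM ((Γ.extend (ps.map Prod.fst) Ps).extend (is.map Prod.fst) Is)
        (dataLabel D Ps Is) choices code →
      ElabIData EWM Γ D ps is choices
        ((D, .defn (dataTerm D Ps Is code) (piTel (Ps ++ Is) (.set 0))) :: Γ)

end IndFam

namespace IndFam

/-! # Algebra of renamings and substitutions -/

-- Extending `Γ` by a definition is legitimate when the name is fresh, the stated type is a type,
-- and the term has that type. Freshness is a premise of elaboration and the type comes from
-- soundness of the checker (`Bidir.sound`), so the content lies in typing `dataTerm`.
--
-- The generated code is typed by induction on elaboration (`ElabPatts.sound`): against a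
-- well-formed label `l` it has type `⟨l⟩`. Two observations make this work. Pattern validation
-- turns indices into constrained indices but changes neither the index type nor the index tuple
-- (`ElabIndices.sound`), so all codes are descriptions over one index type. In an elimination,
-- nothing says directly that the labels of the branches are well formed; they are, because they
-- occur in the type of a well-typed term, which is itself a type (`HasType.regular`), and formation
-- can be inverted (`elim_apps_hasType`).
--
-- The fixpoint needs a functional on the product `J` of the index types, whereas the code lives
-- over the separate index variables. The bridge is the substitution `projSub` of projections of a
-- tuple for those variables. Telescopes of indices are built up one at a time with the invariant
-- `IndexedLabel`. Its delicate clause says that projecting from the tuple of the index variables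
-- returns these variables, but only up to the projection equations. Hence a type under the
-- projections agrees with the original type only judgmentally, and one must know that equal
-- substitutions have equal results (`HasType.subst_eq`).
--
-- The metatheory is kept to what this requires: substitution, inversion of formation rules,
-- regularity of typing and functionality. No normalization, confluence or injectivity of type
-- formers enters: inversion is applied to typing derivations, never to equalities between types.

theorem Term.mutual_induction {P : Term → Prop} {Q : Label → Prop}
    (var : ∀ n, P (.var n)) (set : ∀ k, P (.set k))
    (pi : ∀ A B, P A → P B → P (.pi A B)) (lam : ∀ A t, P A → P t → P (.lam A t))
    (app : ∀ f s, P f → P s → P (.app f s)) (sig : ∀ A B, P A → P B → P (.sig A B))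
    (pair : ∀ B s t, P B → P s → P t → P (.pair B s t))
    (fst : ∀ t, P t → P (.fst t)) (snd : ∀ t, P t → P (.snd t)) (const : ∀ c, P (.const c))
    (desc : ∀ l, Q l → P (.desc l)) (ret : ∀ E T, P E → P T → P (.ret E T))
    (call : ∀ l t, Q l → P t → P (.call l t))
    (name : ∀ D, Q (.name D)) (param : ∀ l A p, Q l → P A → P p → Q (.param l A p))
    (index : ∀ l F i, Q l → P F → P i → Q (.index l F i))
    (constr : ∀ l F i t, Q l → P F → P i → Q (.constr l F i t)) :
    (∀ t, P t) ∧ (∀ l, Q l) :=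
  ⟨Term.rec (motive_2 := Q) var set pi lam app sig pair fst snd const desc ret call name param
      index constr,
    Label.rec (motive_1 := P) var set pi lam app sig pair fst snd const desc ret call name param
      index constr⟩

theorem liftS_var_comp (ρ : ℕ → ℕ) :
    liftS (fun n => .var (ρ n)) = fun n => .var (liftR ρ n) := by
  funext n; cases n <;> rfl

theorem rename_eq_subst_aux :
    (∀ (t : Term) (ρ : ℕ → ℕ), t.rename ρ = t.subst fun n => .var (ρ n)) ∧
    (∀ (l : Label) (ρ : ℕ → ℕ), l.rename ρ = l.subst fun n => .var (ρ n)) := by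
  apply Term.mutual_induction <;> intros <;>
    simp_all [Term.rename, Label.rename, Term.subst, Label.subst, liftS_var_comp]

theorem Term.rename_eq_subst (t : Term) (ρ : ℕ → ℕ) :
    t.rename ρ = t.subst fun n => .var (ρ n) := rename_eq_subst_aux.1 t ρ

theorem Label.rename_eq_subst (l : Label) (ρ : ℕ → ℕ) :
    l.rename ρ = l.subst fun n => .var (ρ n) := rename_eq_subst_aux.2 l ρ

theorem liftS_comp_rename (σ : ℕ → Term) (ρ : ℕ → ℕ) :
    (fun n => liftS σ (liftR ρ n)) = liftS fun n => σ (ρ n) := by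
  funext n; cases n <;> rfl

/-- The composition laws come in a fixed order: renaming before substitution, substitution before
renaming, then two substitutions. Passing a binder in one law uses commutation with weakening,
supplied by the laws before it. -/
theorem subst_rename_aux :
    (∀ (t : Term) (ρ : ℕ → ℕ) (σ : ℕ → Term),
      (t.rename ρ).subst σ = t.subst fun n => σ (ρ n)) ∧
    (∀ (l : Label) (ρ : ℕ → ℕ) (σ : ℕ → Term),
      (l.rename ρ).subst σ = l.subst fun n => σ (ρ n)) := by
  apply Term.mutual_induction <;> intros <;>
    simp_all [Term.rename, Label.rename, Term.subst, Label.subst, liftS_comp_rename]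

theorem Term.wk_rename_liftR (t : Term) (ρ : ℕ → ℕ) :
    t.wk.rename (liftR ρ) = (t.rename ρ).wk := by
  simp only [Term.wk]
  rw [Term.rename_eq_subst (t.rename Nat.succ), subst_rename_aux.1,
    Term.rename_eq_subst (t.rename ρ), subst_rename_aux.1]
  rfl

theorem liftS_rename (σ : ℕ → Term) (ρ : ℕ → ℕ) :
    (fun n => (liftS σ n).rename (liftR ρ)) = liftS fun n => (σ n).rename ρ := by
  funext n
  cases n with
  | zero => rfl
  | succ n => exact Term.wk_rename_liftR _ _

theorem rename_subst_aux :
    (∀ (t : Term) (σ : ℕ → Term) (ρ : ℕ → ℕ),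
      (t.subst σ).rename ρ = t.subst fun n => (σ n).rename ρ) ∧
    (∀ (l : Label) (σ : ℕ → Term) (ρ : ℕ → ℕ),
      (l.subst σ).rename ρ = l.subst fun n => (σ n).rename ρ) := by
  apply Term.mutual_induction <;> intros <;>
    simp_all [Term.rename, Label.rename, Term.subst, Label.subst, liftS_rename]

theorem Term.wk_subst_liftS (t : Term) (σ : ℕ → Term) :
    t.wk.subst (liftS σ) = (t.subst σ).wk := by
  simp only [Term.wk, subst_rename_aux.1, rename_subst_aux.1]
  rfl

theorem liftS_comp (σ τ : ℕ → Term) :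
    (fun n => (liftS σ n).subst (liftS τ)) = liftS fun n => (σ n).subst τ := by
  funext n
  cases n with
  | zero => rfl
  | succ n => exact Term.wk_subst_liftS _ _

theorem subst_subst_aux :
    (∀ (t : Term) (σ τ : ℕ → Term), (t.subst σ).subst τ = t.subst fun n => (σ n).subst τ) ∧
    (∀ (l : Label) (σ τ : ℕ → Term), (l.subst σ).subst τ = l.subst fun n => (σ n).subst τ) := by
  apply Term.mutual_induction <;> intros <;>
    simp_all [Term.subst, Label.subst, liftS_comp]

theorem Term.subst_subst (t : Term) (σ τ : ℕ → Term) :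
    (t.subst σ).subst τ = t.subst fun n => (σ n).subst τ := subst_subst_aux.1 t σ τ

theorem liftS_var : liftS Term.var = Term.var := by
  funext n; cases n <;> rfl

theorem subst_var_aux :
    (∀ t : Term, t.subst .var = t) ∧ (∀ l : Label, l.subst .var = l) := by
  apply Term.mutual_induction <;> intros <;>
    simp_all [Term.subst, Label.subst, liftS_var]

@[simp] theorem Term.subst_var (t : Term) : t.subst .var = t := subst_var_aux.1 t

/-- The substitution of `s` for the outermost variable, followed by `σ`. -/
def scons (s : Term) (σ : ℕ → Term) : ℕ → Term
  | 0 => s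
  | n + 1 => σ n

theorem Term.wk_eq (t : Term) : t.wk = t.subst fun n => .var (n + 1) := t.rename_eq_subst _

theorem Label.wk_eq (l : Label) : l.wk = l.subst fun n => .var (n + 1) := l.rename_eq_subst _

theorem Term.shift_eq (t : Term) (n : ℕ) : t.shift n = t.subst fun m => .var (m + n) :=
  t.rename_eq_subst _

theorem Term.inst_eq (t s : Term) : t.inst s = t.subst (scons s .var) := by
  unfold Term.inst
  congr 1

theorem Term.wk_subst (t : Term) (σ : ℕ → Term) : t.wk.subst σ = t.subst fun n => σ (n + 1) := by
  rw [Term.wk_eq, Term.subst_subst]; rfl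

@[simp] theorem Term.wk_subst_scons (t s : Term) (σ : ℕ → Term) :
    t.wk.subst (scons s σ) = t.subst σ := Term.wk_subst _ _

theorem Term.shift_subst (t : Term) (n : ℕ) (σ : ℕ → Term) :
    (t.shift n).subst σ = t.subst fun m => σ (m + n) := by
  rw [Term.shift_eq, Term.subst_subst]; rfl

@[simp] theorem Term.wk_inst (t s : Term) : t.wk.inst s = t := by
  rw [Term.inst_eq, Term.wk_subst_scons, Term.subst_var]

theorem liftS_comp_scons (σ τ : ℕ → Term) (s : Term) :
    (fun n => (liftS σ n).subst (scons s τ)) = scons s fun n => (σ n).subst τ := by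
  funext n
  cases n with
  | zero => rfl
  | succ n => exact Term.wk_subst_scons _ _ _

theorem Term.subst_liftS_inst (t s : Term) (σ : ℕ → Term) :
    (t.subst (liftS σ)).inst s = t.subst (scons s σ) := by
  rw [Term.inst_eq, Term.subst_subst, liftS_comp_scons]; simp

theorem Term.inst_subst (t s : Term) (σ : ℕ → Term) :
    (t.inst s).subst σ = (t.subst (liftS σ)).inst (s.subst σ) := by
  rw [Term.subst_liftS_inst, Term.inst_eq, Term.subst_subst]
  congr 1
  funext n
  cases n <;> rfl

-- Substitution in labels, computation rules and types of constants

theorem Label.ty_subst (l : Label) (σ : ℕ → Term) : (l.subst σ).ty = l.ty.subst σ := by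
  refine Label.rec (motive_1 := fun _ => True) (motive_2 := fun l => (l.subst σ).ty = l.ty.subst σ)
    ?_ ?_ ?_ ?_ ?_ ?_ ?_ ?_ ?_ ?_ ?_ ?_ ?_ ?_ ?_ ?_ ?_ l <;> intros <;>
    simp_all [Label.subst, Label.ty, Term.subst]

theorem Label.ix_subst (l : Label) (σ : ℕ → Term) : (l.subst σ).ix = l.ix.subst σ := by
  refine Label.rec (motive_1 := fun _ => True) (motive_2 := fun l => (l.subst σ).ix = l.ix.subst σ)
    ?_ ?_ ?_ ?_ ?_ ?_ ?_ ?_ ?_ ?_ ?_ ?_ ?_ ?_ ?_ ?_ ?_ l <;> intros <;>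
    simp_all [Label.subst, Label.ix, Term.subst]

theorem Label.ty_wk (l : Label) : l.wk.ty = l.ty.wk := by
  rw [Label.wk_eq, Label.ty_subst, Term.wk_eq]

theorem Label.ix_wk (l : Label) : l.wk.ix = l.ix.wk := by
  rw [Label.wk_eq, Label.ix_subst, Term.wk_eq]

/-- The equations are schematic in their arguments; those arguments that occur under a binder are
weakened, which commutes with lifting. Only `call_ret` involves a computed index type, whence
`Label.ty_subst`. -/
theorem Comp.subst {s t : Term} (h : Comp s t) (σ : ℕ → Term) :
    Comp (s.subst σ) (t.subst σ) := by
  cases h <;> simp only [Term.subst, Term.wk_subst_liftS, ← Label.ty_subst, liftS] <;>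
    constructor

theorem constType_subst (c : Const) (σ : ℕ → Term) : (constType c).subst σ = constType c := by
  cases c <;> rfl

open Term

/-! # Stability of derivations under substitution -/

def Jdg.ctx : Jdg → Ctx
  | .valid Γ => Γ
  | .type Γ _ _ => Γ
  | .eq Γ _ _ _ => Γ
  | .tel Γ _ => Γ
  | .telEq Γ _ _ => Γ

def Jdg.subst (Δ : Ctx) (σ : ℕ → Term) : Jdg → Jdg
  | .valid _ => .valid Δ
  | .type _ t T => .type Δ (t.subst σ) (T.subst σ)
  | .eq _ s t T => .eq Δ (s.subst σ) (t.subst σ) (T.subst σ)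
  | .tel _ l => .tel Δ (l.subst σ)
  | .telEq _ l l' => .telEq Δ (l.subst σ) (l'.subst σ)

/-- A class of well-formed substitutions that is closed under binders. -/
structure SubstClass (S : Ctx → (ℕ → Term) → Ctx → Prop) : Prop where
  valid : ∀ {Δ σ Γ}, S Δ σ Γ → Der (.valid Δ)
  var : ∀ {Δ σ Γ n e}, S Δ σ Γ → Γ[n]? = some e →
    Der (.type Δ (σ n) ((e.ty.shift (n + 1)).subst σ))
  defn : ∀ {Δ σ Γ n t A}, S Δ σ Γ → Γ[n]? = some (.defn t A) →
    Der (.eq Δ (σ n) ((t.shift (n + 1)).subst σ) ((A.shift (n + 1)).subst σ))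
  lift : ∀ {Δ σ Γ A k}, S Δ σ Γ → Der (.type Δ (A.subst σ) (set k)) →
    S (.decl (A.subst σ) :: Δ) (liftS σ) (.decl A :: Γ)

/-- The type of the last entry of a context remains a type under the substitutions of `S`. -/
def LastStable (S : Ctx → (ℕ → Term) → Ctx → Prop) : Ctx → Prop
  | [] => True
  | e :: Γ => ∀ Δ σ, S Δ σ Γ → ∃ k, Der (.type Δ (e.ty.subst σ) (set k))

/-- Rules such as pairing go under a binder without a premise that the domain is a type. Stability
of the last context entry supplies what lifting the substitution needs there. -/
theorem LastStable.lift {S} (hS : SubstClass S) {Γ Δ : Ctx} {σ A}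
    (h : LastStable S (.decl A :: Γ)) (hσ : S Δ σ Γ) :
    S (.decl (A.subst σ) :: Δ) (liftS σ) (.decl A :: Γ) :=
  let ⟨_, hk⟩ := h Δ σ hσ
  hS.lift hσ hk

/-- One induction serves renamings and typed substitutions alike. The second conjunct strengthens
the induction: it originates in the context formation rules, whose premise types the last entry, and
all other rules inherit it from a premise over the same context. -/
theorem Der.subst_aux {S} (hS : SubstClass S) {J : Jdg} (h : Der J) :
    (∀ Δ σ, S Δ σ J.ctx → Der (J.subst Δ σ)) ∧ LastStable S J.ctx := by
  induction h with
  | valid_nil => exact ⟨fun Δ σ h => hS.valid h, trivial⟩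
  | valid_decl _ _ _ ih => exact ⟨fun Δ σ h => hS.valid h, fun Δ σ h => ⟨_, ih.1 Δ σ h⟩⟩
  | valid_defn _ _ _ _ ih _ => exact ⟨fun Δ σ h => hS.valid h, fun Δ σ h => ⟨_, ih.1 Δ σ h⟩⟩
  | var _ hn ih => exact ⟨fun Δ σ h => hS.var h hn, ih.2⟩
  | set k _ ih => exact ⟨fun Δ σ h => .set k (ih.1 Δ σ h), ih.2⟩
  | const c _ ih =>
    refine ⟨fun Δ σ h => ?_, ih.2⟩
    simp only [Jdg.subst, constType_subst]
    exact .const c (ih.1 Δ σ h)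
  | pi _ _ ihA ihB => exact ⟨fun Δ σ h => .pi (ihA.1 _ _ h) (ihB.1 _ _ (ihB.2.lift hS h)), ihA.2⟩
  | lam _ _ ihA ihB => exact ⟨fun Δ σ h => .lam (ihA.1 _ _ h) (ihB.1 _ _ (ihB.2.lift hS h)), ihA.2⟩
  | app _ _ ihf ihs =>
    refine ⟨fun Δ σ h => ?_, ihf.2⟩
    simp only [Jdg.subst, inst_subst]
    exact .app (ihf.1 _ _ h) (ihs.1 _ _ h)
  | sig _ _ ihA ihB => exact ⟨fun Δ σ h => .sig (ihA.1 _ _ h) (ihB.1 _ _ (ihB.2.lift hS h)), ihA.2⟩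
  | pair _ _ _ ihs ihB iht =>
    refine ⟨fun Δ σ h => .pair (ihs.1 _ _ h) (ihB.1 _ _ (ihB.2.lift hS h)) ?_, ihs.2⟩
    have := iht.1 _ _ h
    rwa [Jdg.subst, inst_subst] at this
  | fst _ ih => exact ⟨fun Δ σ h => .fst (ih.1 _ _ h), ih.2⟩
  | snd _ ih =>
    refine ⟨fun Δ σ h => ?_, ih.2⟩
    simp only [Jdg.subst, inst_subst]
    exact .snd (ih.1 _ _ h)
  | desc _ ih => exact ⟨fun Δ σ h => .desc (ih.1 _ _ h), ih.2⟩
  | ret _ _ _ ihl ihE ihT =>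
    refine ⟨fun Δ σ h => .ret (ihl.1 _ _ h) (ihE.1 _ _ h) ?_, ihl.2⟩
    simpa only [Jdg.subst, Term.subst, wk_subst_liftS, Label.ty_subst] using ihT.1 _ _ h
  | call _ _ ihl iht =>
    refine ⟨fun Δ σ h => ?_, ihl.2⟩
    simp only [Jdg.subst, Term.subst, ← Label.ty_subst]
    exact .call (ihl.1 _ _ h) (iht.1 _ _ h)
  | cumul _ hk ih => exact ⟨fun Δ σ h => .cumul (ih.1 _ _ h) hk, ih.2⟩
  | conv _ _ _ iht ihe ihB =>
    exact ⟨fun Δ σ h => .conv (iht.1 _ _ h) (ihe.1 _ _ h) (ihB.1 _ _ h), iht.2⟩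
  | tel_name D _ ih => exact ⟨fun Δ σ h => .tel_name D (ih.1 _ _ h), ih.2⟩
  | tel_param _ _ _ ihl ihP ihp =>
    exact ⟨fun Δ σ h => .tel_param (ihl.1 _ _ h) (ihP.1 _ _ h) (ihp.1 _ _ h), ihl.2⟩
  | tel_index _ _ _ ihl ihF ihi =>
    refine ⟨fun Δ σ h => .tel_index (ihl.1 _ _ h) ?_ ?_, ihl.2⟩
    · rw [Label.ty_subst]; exact ihF.1 _ _ (ihF.2.lift hS h)
    · have := ihi.1 _ _ h
      rwa [Jdg.subst, inst_subst, ← Label.ix_subst] at this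
  | tel_constr t _ _ _ ihl ihF ihi =>
    refine ⟨fun Δ σ h => .tel_constr t (ihl.1 _ _ h) ?_ ?_, ihl.2⟩
    · rw [Label.ty_subst]; exact ihF.1 _ _ (ihF.2.lift hS h)
    · have := ihi.1 _ _ h
      rwa [Jdg.subst, inst_subst, ← Label.ix_subst] at this
  | beta _ _ _ ihA iht ihs =>
    refine ⟨fun Δ σ h => ?_, ihA.2⟩
    simp only [Jdg.subst, inst_subst]
    exact .beta (ihA.1 _ _ h) (iht.1 _ _ (iht.2.lift hS h)) (ihs.1 _ _ h)
  | fst_pair _ _ _ ihs ihB iht =>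
    refine ⟨fun Δ σ h => .fst_pair (ihs.1 _ _ h) (ihB.1 _ _ (ihB.2.lift hS h)) ?_, ihs.2⟩
    have := iht.1 _ _ h
    rwa [Jdg.subst, inst_subst] at this
  | snd_pair _ _ _ ihs ihB iht =>
    refine ⟨fun Δ σ h => ?_, ihs.2⟩
    have := iht.1 _ _ h
    simp only [Jdg.subst, inst_subst] at this ⊢
    exact .snd_pair (ihs.1 _ _ h) (ihB.1 _ _ (ihB.2.lift hS h)) this
  | delta _ hn ih => exact ⟨fun Δ σ h => hS.defn h hn, ih.2⟩
  | comp hc _ _ ihs iht => exact ⟨fun Δ σ h => .comp (hc.subst σ) (ihs.1 _ _ h) (iht.1 _ _ h), ihs.2⟩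
  | eq_refl _ ih => exact ⟨fun Δ σ h => .eq_refl (ih.1 _ _ h), ih.2⟩
  | eq_symm _ ih => exact ⟨fun Δ σ h => .eq_symm (ih.1 _ _ h), ih.2⟩
  | eq_trans _ _ ih ih' => exact ⟨fun Δ σ h => .eq_trans (ih.1 _ _ h) (ih'.1 _ _ h), ih.2⟩
  | eq_conv _ _ _ iht ihe ihB =>
    exact ⟨fun Δ σ h => .eq_conv (iht.1 _ _ h) (ihe.1 _ _ h) (ihB.1 _ _ h), iht.2⟩
  | eq_cumul _ hk ih => exact ⟨fun Δ σ h => .eq_cumul (ih.1 _ _ h) hk, ih.2⟩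
  | eq_pi _ _ _ ihA ihA' ihB =>
    exact ⟨fun Δ σ h => .eq_pi (ihA.1 _ _ h) (ihA'.1 _ _ h) (ihB.1 _ _ (ihB.2.lift hS h)), ihA.2⟩
  | eq_lam _ _ _ ihA ihA' ihB =>
    exact ⟨fun Δ σ h => .eq_lam (ihA.1 _ _ h) (ihA'.1 _ _ h) (ihB.1 _ _ (ihB.2.lift hS h)), ihA.2⟩
  | eq_app _ _ ihf ihs =>
    refine ⟨fun Δ σ h => ?_, ihf.2⟩
    simp only [Jdg.subst, inst_subst]
    exact .eq_app (ihf.1 _ _ h) (ihs.1 _ _ h)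
  | eq_sig _ _ _ ihA ihA' ihB =>
    exact ⟨fun Δ σ h => .eq_sig (ihA.1 _ _ h) (ihA'.1 _ _ h) (ihB.1 _ _ (ihB.2.lift hS h)), ihA.2⟩
  | eq_pair _ _ _ _ _ ihA ihB ihB' ihs iht =>
    refine ⟨fun Δ σ h => .eq_pair (ihA.1 _ _ h) (ihB.1 _ _ (ihB.2.lift hS h))
      (ihB'.1 _ _ (ihB.2.lift hS h)) (ihs.1 _ _ h) ?_, ihA.2⟩
    have := iht.1 _ _ h
    rwa [Jdg.subst, inst_subst] at this
  | eq_fst _ ih => exact ⟨fun Δ σ h => .eq_fst (ih.1 _ _ h), ih.2⟩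
  | eq_snd _ ih =>
    refine ⟨fun Δ σ h => ?_, ih.2⟩
    simp only [Jdg.subst, inst_subst]
    exact .eq_snd (ih.1 _ _ h)
  | eq_desc _ ih => exact ⟨fun Δ σ h => .eq_desc (ih.1 _ _ h), ih.2⟩
  | eq_ret _ _ _ ihl ihE ihT =>
    refine ⟨fun Δ σ h => .eq_ret (ihl.1 _ _ h) (ihE.1 _ _ h) ?_, ihl.2⟩
    simpa only [Jdg.subst, Term.subst, wk_subst_liftS, Label.ty_subst] using ihT.1 _ _ h
  | eq_call _ _ ihl iht =>
    refine ⟨fun Δ σ h => ?_, ihl.2⟩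
    simp only [Jdg.subst, Term.subst, ← Label.ty_subst]
    exact .eq_call (ihl.1 _ _ h) (iht.1 _ _ h)
  | telEq_name D _ ih => exact ⟨fun Δ σ h => .telEq_name D (ih.1 _ _ h), ih.2⟩
  | telEq_param _ _ _ ihl ihP ihp =>
    exact ⟨fun Δ σ h => .telEq_param (ihl.1 _ _ h) (ihP.1 _ _ h) (ihp.1 _ _ h), ihl.2⟩
  | telEq_index _ _ _ _ _ ihl ihl' ihF ihF' ihi =>
    refine ⟨fun Δ σ h => .telEq_index (ihl.1 _ _ h) (ihl'.1 _ _ h) ?_ ?_ ?_, ihl.2⟩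
    · rw [Label.ty_subst]; exact ihF.1 _ _ (ihF.2.lift hS h)
    · rw [Label.ty_subst]; exact ihF'.1 _ _ (ihF.2.lift hS h)
    · have := ihi.1 _ _ h
      rwa [Jdg.subst, inst_subst, ← Label.ix_subst] at this
  | telEq_constr t _ _ _ _ _ ihl ihl' ihF ihF' ihi =>
    refine ⟨fun Δ σ h => .telEq_constr t (ihl.1 _ _ h) (ihl'.1 _ _ h) ?_ ?_ ?_, ihl.2⟩
    · rw [Label.ty_subst]; exact ihF.1 _ _ (ihF.2.lift hS h)
    · rw [Label.ty_subst]; exact ihF'.1 _ _ (ihF.2.lift hS h)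
    · have := ihi.1 _ _ h
      rwa [Jdg.subst, inst_subst, ← Label.ix_subst] at this

/-! ## Validity of contexts -/

theorem Der.ctx_valid {J : Jdg} (h : Der J) : Der (.valid J.ctx) := by
  induction h with
  | valid_nil => exact .valid_nil
  | valid_decl h h' => exact .valid_decl h h'
  | valid_defn h h' h'' => exact .valid_defn h h' h''
  | _ => assumption

theorem Der.valid_tail {e : Entry} {Γ : Ctx} (h : Der (.valid (e :: Γ))) : Der (.valid Γ) := by
  cases h <;> assumption

theorem Der.valid_head {e : Entry} {Γ : Ctx} (h : Der (.valid (e :: Γ))) :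
    ∃ k, HasType Γ e.ty (.set k) := by
  cases h <;> exact ⟨_, by assumption⟩

/-! ## Renamings -/

def Entry.subst (σ : ℕ → Term) : Entry → Entry
  | .decl A => .decl (A.subst σ)
  | .defn t A => .defn (t.subst σ) (A.subst σ)

theorem Entry.ty_subst (σ : ℕ → Term) (e : Entry) : (e.subst σ).ty = e.ty.subst σ := by
  cases e <;> rfl

/-- A renaming of the variables of `Γ` by variables of `Δ`, as a substitution. -/
def WfRen (Δ : Ctx) (σ : ℕ → Term) (Γ : Ctx) : Prop :=
  Der (.valid Δ) ∧ ∃ ρ : ℕ → ℕ, (∀ n, σ n = .var (ρ n)) ∧ ∀ n e, Γ[n]? = some e →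
    ∃ e', Δ[ρ n]? = some e' ∧
      e'.subst (fun m => .var (m + (ρ n + 1))) = e.subst fun m => σ (m + (n + 1))

/-- For renamings, lifting under a binder compares context entries purely syntactically and needs no
weakening of derivations. This instance therefore comes first, and weakening is read off from it. -/
theorem wfRen_substClass : SubstClass WfRen where
  valid h := h.1
  var := by
    rintro Δ σ Γ n e ⟨hΔ, ρ, hρ, h⟩ hn
    obtain ⟨e', he', heq⟩ := h n e hn
    have := Der.var hΔ he'
    rwa [Term.shift_eq, ← Entry.ty_subst, heq, Entry.ty_subst, ← Term.shift_subst, ← hρ] at this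
  defn := by
    rintro Δ σ Γ n t A ⟨hΔ, ρ, hρ, h⟩ hn
    obtain ⟨e', he', heq⟩ := h n _ hn
    cases e' with
    | decl A' => simp [Entry.subst] at heq
    | defn t' A' =>
      simp only [Entry.subst, Entry.defn.injEq] at heq
      have := Der.delta hΔ he'
      rwa [Term.shift_eq, Term.shift_eq, heq.1, heq.2, ← Term.shift_subst, ← Term.shift_subst,
        ← hρ] at this
  lift := by
    rintro Δ σ Γ A k ⟨hΔ, ρ, hρ, h⟩ hA
    have hσ : σ = fun n => .var (ρ n) := funext hρ
    refine ⟨.valid_decl hΔ hA, liftR ρ, fun n => by rw [hσ, liftS_var_comp], ?_⟩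
    rintro (_ | n) e hn
    · obtain rfl : Entry.decl A = e := by simpa using hn
      refine ⟨.decl (A.subst σ), rfl, ?_⟩
      simp only [Entry.subst, Term.subst_subst, hσ]
      rfl
    · obtain ⟨e', he', heq⟩ := h n e (by simpa using hn)
      refine ⟨e', by simpa [liftR] using he', ?_⟩
      -- Older entries match as before, both sides being weakened past the new binder.
      have := congrArg (Entry.subst fun n => .var (n + 1)) heq
      rw [hσ] at this ⊢
      cases e <;> cases e' <;> simp [Entry.subst, Term.subst_subst, Term.subst] at this ⊢ <;>
        exact this

/-- Weakening by one entry. -/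
theorem wfRen_wk {Γ : Ctx} {e : Entry} (h : Der (.valid (e :: Γ))) :
    WfRen (e :: Γ) (fun n => .var (n + 1)) Γ :=
  ⟨h, Nat.succ, fun _ => rfl, fun n e' he' => ⟨e', by simpa using he', by
    congr 1⟩⟩

theorem HasType.wk {Γ : Ctx} {e : Entry} {t T : Term} (h : HasType Γ t T)
    (he : Der (.valid (e :: Γ))) : HasType (e :: Γ) t.wk T.wk := by
  rw [Term.wk_eq, Term.wk_eq]
  exact (Der.subst_aux wfRen_substClass h).1 _ _ (wfRen_wk he)

theorem EqType.wk {Γ : Ctx} {e : Entry} {s t T : Term} (h : EqType Γ s t T)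
    (he : Der (.valid (e :: Γ))) : EqType (e :: Γ) s.wk t.wk T.wk := by
  rw [Term.wk_eq, Term.wk_eq, Term.wk_eq]
  exact (Der.subst_aux wfRen_substClass h).1 _ _ (wfRen_wk he)

theorem tel_wk {Γ : Ctx} {e : Entry} {l : Label} (h : Der (.tel Γ l))
    (he : Der (.valid (e :: Γ))) : Der (.tel (e :: Γ) l.wk) := by
  rw [Label.wk_eq]
  exact (Der.subst_aux wfRen_substClass h).1 _ _ (wfRen_wk he)

/-! ## Typed substitutions -/

/-- `σ` replaces the variables of `Γ` by terms over `Δ`. -/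
def WfSub (Δ : Ctx) (σ : ℕ → Term) (Γ : Ctx) : Prop :=
  Der (.valid Δ) ∧ ∀ n e, Γ[n]? = some e →
    HasType Δ (σ n) (e.ty.subst fun m => σ (m + (n + 1))) ∧
    ∀ t A, e = .defn t A →
      EqType Δ (σ n) (t.subst fun m => σ (m + (n + 1))) (A.subst fun m => σ (m + (n + 1)))

/-- Under a binder every substituted term is weakened, so the lifting clause rests on weakening of
derivations, already available from renamings. -/
theorem wfSub_substClass : SubstClass WfSub where
  valid h := h.1
  var h hn := by rw [Term.shift_subst]; exact (h.2 _ _ hn).1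
  defn h hn := by rw [Term.shift_subst, Term.shift_subst]; exact (h.2 _ _ hn).2 _ _ rfl
  lift := by
    rintro Δ σ Γ A k ⟨hΔ, h⟩ hA
    have hv := Der.valid_decl hΔ hA
    have key : ∀ (n : ℕ) (t : Term), (t.subst fun m => liftS σ (m + (n + 1 + 1))) =
        (t.subst fun m => σ (m + (n + 1))).wk := fun n t => by
      rw [Term.wk_eq, Term.subst_subst]
      congr 1
      funext m
      exact Term.wk_eq _
    refine ⟨hv, ?_⟩
    rintro (_ | n) e hn
    · obtain rfl : Entry.decl A = e := by simpa using hn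
      refine ⟨?_, fun t A h => by cases h⟩
      have := Der.var (n := 0) hv rfl
      rw [Term.shift_eq, Entry.ty, Term.subst_subst] at this
      have hl : (fun m => liftS σ (m + (0 + 1))) = fun n => (σ n).subst fun m => .var (m + (0 + 1)) :=
        funext fun m => Term.wk_eq _
      rw [Entry.ty, hl]
      exact this
    · obtain ⟨h1, h2⟩ := h n e (by simpa using hn)
      refine ⟨?_, fun t A he => ?_⟩
      · rw [key]; exact HasType.wk h1 hv
      · rw [key, key]; exact EqType.wk (h2 t A he) hv

theorem HasType.subst {Γ Δ : Ctx} {t T : Term} {σ} (h : HasType Γ t T) (hσ : WfSub Δ σ Γ) :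
    HasType Δ (t.subst σ) (T.subst σ) := (Der.subst_aux wfSub_substClass h).1 _ _ hσ

theorem EqType.subst {Γ Δ : Ctx} {s t T : Term} {σ} (h : EqType Γ s t T) (hσ : WfSub Δ σ Γ) :
    EqType Δ (s.subst σ) (t.subst σ) (T.subst σ) := (Der.subst_aux wfSub_substClass h).1 _ _ hσ

theorem tel_subst {Γ Δ : Ctx} {l : Label} {σ} (h : Der (.tel Γ l)) (hσ : WfSub Δ σ Γ) :
    Der (.tel Δ (l.subst σ)) := (Der.subst_aux wfSub_substClass h).1 _ _ hσ

theorem WfSub.id {Γ : Ctx} (h : Der (.valid Γ)) : WfSub Γ .var Γ :=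
  ⟨h, fun _ e he => ⟨by simpa only [Term.shift_eq] using Der.var h he, fun t A hd => by
    subst hd; simpa only [Term.shift_eq] using Der.delta h he⟩⟩

theorem WfSub.wk {Γ : Ctx} {e : Entry} (h : Der (.valid (e :: Γ))) :
    WfSub (e :: Γ) (fun n => .var (n + 1)) Γ :=
  ⟨h, fun n e' he' => by
    have := (WfSub.id h).2 (n + 1) e' (by simpa using he')
    simpa only [Nat.add_assoc, Nat.add_comm 1] using this⟩

theorem WfSub.comp {Γ Δ Θ : Ctx} {σ τ} (hσ : WfSub Δ σ Γ) (hτ : WfSub Θ τ Δ) :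
    WfSub Θ (fun n => (σ n).subst τ) Γ :=
  ⟨hτ.1, fun n e he => ⟨by
    simpa only [Term.subst_subst] using HasType.subst (hσ.2 n e he).1 hτ, fun t A hd => by
    simpa only [Term.subst_subst] using EqType.subst ((hσ.2 n e he).2 t A hd) hτ⟩⟩

theorem WfSub.scons {Γ Δ : Ctx} {σ} {s A : Term} (hσ : WfSub Δ σ Γ)
    (hs : HasType Δ s (A.subst σ)) : WfSub Δ (scons s σ) (.decl A :: Γ) := by
  refine ⟨hσ.1, ?_⟩
  rintro (_ | n) e hn
  · obtain rfl : Entry.decl A = e := by simpa using hn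
    exact ⟨hs, fun t A h => by cases h⟩
  · exact hσ.2 n e (by simpa using hn)

theorem HasType.inst {Γ : Ctx} {s t A T : Term} (h : HasType (.decl A :: Γ) t T)
    (hs : HasType Γ s A) : HasType Γ (t.inst s) (T.inst s) := by
  rw [inst_eq, inst_eq]
  exact HasType.subst h (WfSub.scons (.id hs.ctx_valid) (by rwa [subst_var]))

/-! # Inversion and regularity -/

/-- Keeping `T` arbitrary, instead of demanding a universe, lets the conversion case transport both
conclusions along the same equality; nothing about the shape of `T` has to be known. -/
theorem HasType.pi_inv {Γ : Ctx} {A B T : Term} (h : HasType Γ (.pi A B) T) :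
    HasType Γ A T ∧ HasType (.decl A :: Γ) B T.wk := by
  unfold HasType at h
  generalize hJ : Jdg.type Γ (.pi A B) T = J at h
  induction h generalizing T with
  | pi hA hB =>
    cases hJ
    exact ⟨hA, hB⟩
  | cumul _ hk ih =>
    cases hJ
    exact ⟨.cumul (ih rfl).1 hk, .cumul (ih rfl).2 hk⟩
  | conv _ he hB ih =>
    cases hJ
    obtain ⟨h1, h2⟩ := ih rfl
    exact ⟨.conv h1 he hB, .conv h2 (EqType.wk he h2.ctx_valid) (HasType.wk hB h2.ctx_valid)⟩
  | _ => cases hJ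

theorem HasType.sig_inv {Γ : Ctx} {A B T : Term} (h : HasType Γ (.sig A B) T) :
    HasType Γ A T ∧ HasType (.decl A :: Γ) B T.wk := by
  unfold HasType at h
  generalize hJ : Jdg.type Γ (.sig A B) T = J at h
  induction h generalizing T with
  | sig hA hB =>
    cases hJ
    exact ⟨hA, hB⟩
  | cumul _ hk ih =>
    cases hJ
    exact ⟨.cumul (ih rfl).1 hk, .cumul (ih rfl).2 hk⟩
  | conv _ he hB ih =>
    cases hJ
    obtain ⟨h1, h2⟩ := ih rfl
    exact ⟨.conv h1 he hB, .conv h2 (EqType.wk he h2.ctx_valid) (HasType.wk hB h2.ctx_valid)⟩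
  | _ => cases hJ

theorem HasType.desc_inv {Γ : Ctx} {l : Label} {T : Term} (h : HasType Γ (.desc l) T) :
    Der (.tel Γ l) := by
  unfold HasType at h
  generalize hJ : Jdg.type Γ (.desc l) T = J at h
  induction h generalizing T with
  | desc hl => cases hJ; exact hl
  | cumul _ _ ih => cases hJ; exact ih rfl
  | conv _ _ _ ih => cases hJ; exact ih rfl
  | _ => cases hJ

theorem tel_ty {Γ : Ctx} {l : Label} (h : Der (.tel Γ l)) : HasType Γ l.ty (.set 1) := by
  generalize hJ : Jdg.tel Γ l = J at h
  induction h generalizing l with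
  | tel_name D hΓ => cases hJ; exact .cumul (.const .unit hΓ) (Nat.zero_le 1)
  | tel_param _ _ _ ih => cases hJ; have := ih rfl; exact this
  | tel_index _ hF _ ih => cases hJ; exact .sig (ih rfl) hF
  | tel_constr _ _ hF _ ih => cases hJ; exact .sig (ih rfl) hF
  | _ => cases hJ

theorem tel_ix {Γ : Ctx} {l : Label} (h : Der (.tel Γ l)) : HasType Γ l.ix l.ty := by
  generalize hJ : Jdg.tel Γ l = J at h
  induction h generalizing l with
  | tel_name D hΓ => cases hJ; exact .const .void hΓ
  | tel_param _ _ _ ih => cases hJ; have := ih rfl; exact this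
  | tel_index _ hF hi ih => cases hJ; exact .pair (ih rfl) hF hi
  | tel_constr _ _ hF hi ih => cases hJ; exact .pair (ih rfl) hF hi
  | _ => cases hJ

/-! # Typing of the constants -/

theorem HasType.var' {Γ : Ctx} {T : Term} (h : Der (.valid Γ)) (n : ℕ) {e : Entry}
    (hn : Γ[n]? = some e) (hT : e.ty.shift (n + 1) = T) : HasType Γ (var n) T :=
  hT ▸ Der.var h hn

/-- Formation wants a common level, which cumulativity provides. Passing the validity of the
extended context to the codomain lets nested types be checked without building their contexts by
hand. -/
theorem HasType.pi_max {Γ : Ctx} {A B : Term} {j k : ℕ} (hA : HasType Γ A (set j))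
    (hB : Der (.valid (.decl A :: Γ)) → HasType (.decl A :: Γ) B (set k)) :
    HasType Γ (pi A B) (set (max j k)) :=
  .pi (.cumul hA (le_max_left j k)) (.cumul (hB (.valid_decl hA.ctx_valid hA)) (le_max_right j k))

theorem HasType.sig_max {Γ : Ctx} {A B : Term} {j k : ℕ} (hA : HasType Γ A (set j))
    (hB : HasType (.decl A :: Γ) B (set k)) : HasType Γ (sig A B) (set (max j k)) :=
  .sig (.cumul hA (le_max_left j k)) (.cumul hB (le_max_right j k))

theorem HasType.valid_decl {Γ : Ctx} {A : Term} {k : ℕ} (hA : HasType Γ A (set k)) :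
    Der (.valid (.decl A :: Γ)) := .valid_decl hA.ctx_valid hA

theorem HasType.arr_max {Γ : Ctx} {A B : Term} {j k : ℕ} (hA : HasType Γ A (set j))
    (hB : HasType Γ B (set k)) : HasType Γ (arr A B) (set (max j k)) :=
  .pi_max hA fun h => HasType.wk hB h

theorem HasType.app_arr {Γ : Ctx} {A B f a : Term} (hf : HasType Γ f (arr A B))
    (ha : HasType Γ a A) : HasType Γ (app f a) B := by
  simpa using Der.app hf ha

theorem HasType.const_subst {Γ : Ctx} (c : Const) (h : Der (.valid Γ)) :
    HasType Γ (const c) ((constType c).subst var) := by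
  rw [subst_var]; exact .const c h

/-- Arguments accumulate in one simultaneous substitution instead of nested instantiations. Starting
from the identity at a constant with closed type, the resulting types then reduce by computation to
the expected ones, without commutation lemmas. -/
theorem HasType.app_subst {Γ : Ctx} {A B f a : Term} {σ} (hf : HasType Γ f ((pi A B).subst σ))
    (ha : HasType Γ a (A.subst σ)) : HasType Γ (app f a) (B.subst (scons a σ)) := by
  rw [← subst_liftS_inst]
  exact .app hf ha

theorem HasType.app_pi {Γ : Ctx} {A B f a : Term} (hf : HasType Γ f (pi A B))
    (ha : HasType Γ a A) : HasType Γ (app f a) (B.inst a) := Der.app hf ha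

theorem HasType.pair_sig {Γ : Ctx} {A B s t : Term} {k : ℕ} (hs : HasType Γ s A)
    (hB : HasType (.decl A :: Γ) B (set k)) (ht : HasType Γ t (B.inst s)) :
    HasType Γ (pair B s t) (sig A B) := Der.pair hs hB ht

section constants

variable {Γ : Ctx}

theorem HasType.unit (h : Der (.valid Γ)) : HasType Γ unit (set 0) := .const .unit h

theorem HasType.uid (h : Der (.valid Γ)) : HasType Γ uid (set 0) := .const .uid h

theorem HasType.enumU (h : Der (.valid Γ)) : HasType Γ enumU (set 0) := .const .enumU h

theorem HasType.enumT {E : Term} (hE : HasType Γ E Term.enumU) : HasType Γ (enumT E) (set 0) :=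
  .app_subst (.const_subst .enumT hE.ctx_valid) hE

theorem HasType.consE {t E : Term} (ht : HasType Γ t Term.uid) (hE : HasType Γ E Term.enumU) :
    HasType Γ (consE t E) Term.enumU :=
  .app_subst (.app_subst (.const_subst .consE hE.ctx_valid) ht) hE

theorem HasType.zeroE {t E : Term} (ht : HasType Γ t Term.uid) (hE : HasType Γ E Term.enumU) :
    HasType Γ (zeroE t E) (Term.enumT (Term.consE t E)) :=
  .app_subst (.app_subst (.const_subst .zeroE hE.ctx_valid) ht) hE

theorem HasType.sucE {t E n : Term} (ht : HasType Γ t Term.uid) (hE : HasType Γ E Term.enumU)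
    (hn : HasType Γ n (Term.enumT E)) : HasType Γ (sucE t E n) (Term.enumT (Term.consE t E)) :=
  .app_subst (.app_subst (.app_subst (.const_subst .sucE hE.ctx_valid) ht) hE) hn

theorem HasType.spi {k : ℕ} {E P : Term} (hE : HasType Γ E Term.enumU)
    (hP : HasType Γ P (arr (Term.enumT E) (set k))) : HasType Γ (spi k E P) (set k) :=
  .app_subst (.app_subst (.const_subst (.spi k) hE.ctx_valid) hE) hP

theorem HasType.enumElim {k : ℕ} {E P es : Term} (hE : HasType Γ E Term.enumU)
    (hP : HasType Γ P (arr (Term.enumT E) (set k))) (hes : HasType Γ es (Term.spi k E P)) :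
    HasType Γ (enumElim k E P es) (pi (Term.enumT E) (app P.wk (var 0))) :=
  .app_subst (.app_subst (.app_subst (.const_subst (.enumElim k) hE.ctx_valid) hE) hP) hes

theorem HasType.eq {k : ℕ} {A a b : Term} (hA : HasType Γ A (set k)) (ha : HasType Γ a A)
    (hb : HasType Γ b A) : HasType Γ (eq k A a b) (set 0) :=
  .app_subst (.app_subst (.app_subst (.const_subst (.eq k) hA.ctx_valid) hA) ha) hb

theorem HasType.refl {k : ℕ} {A a : Term} (hA : HasType Γ A (set k)) (ha : HasType Γ a A) :
    HasType Γ (refl k A a) (Term.eq k A a a) :=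
  .app_subst (.app_subst (.const_subst (.refl k) hA.ctx_valid) hA) ha

variable {I : Term} (hI : HasType Γ I (set 1))
include hI

theorem HasType.idesc : HasType Γ (idesc I) (set 1) :=
  .app_subst (.const_subst .idesc hI.ctx_valid) hI

theorem HasType.dvar {i : Term} (hi : HasType Γ i I) : HasType Γ (dvar I i) (Term.idesc I) :=
  .app_subst (.app_subst (.const_subst .dvar hI.ctx_valid) hI) hi

theorem HasType.dunit : HasType Γ (dunit I) (Term.idesc I) :=
  .app_subst (.const_subst .dunit hI.ctx_valid) hI

theorem HasType.dtimes {A B : Term} (hA : HasType Γ A (Term.idesc I))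
    (hB : HasType Γ B (Term.idesc I)) : HasType Γ (dtimes I A B) (Term.idesc I) :=
  .app_subst (.app_subst (.app_subst (.const_subst .dtimes hI.ctx_valid) hI) hA) hB

theorem HasType.dpi {S T : Term} (hS : HasType Γ S (set 0))
    (hT : HasType Γ T (arr S (Term.idesc I))) : HasType Γ (dpi I S T) (Term.idesc I) :=
  .app_subst (.app_subst (.app_subst (.const_subst .dpi hI.ctx_valid) hI) hS) hT

theorem HasType.dsigma {S T : Term} (hS : HasType Γ S (set 0))
    (hT : HasType Γ T (arr S (Term.idesc I))) : HasType Γ (dsigma I S T) (Term.idesc I) :=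
  .app_subst (.app_subst (.app_subst (.const_subst .dsigma hI.ctx_valid) hI) hS) hT

theorem HasType.interp {D X : Term} (hD : HasType Γ D (Term.idesc I))
    (hX : HasType Γ X (arr I (set 0))) : HasType Γ (interp I D X) (set 0) :=
  .app_subst (.app_subst (.app_subst (.const_subst .interp hI.ctx_valid) hI) hD) hX

theorem HasType.imu {R : Term} (hR : HasType Γ R (arr I (Term.idesc I))) :
    HasType Γ (imu I R) (arr I (set 0)) :=
  .app_subst (.app_subst (.const_subst .imu hI.ctx_valid) hI) hR

theorem HasType.imu_app {R i : Term} (hR : HasType Γ R (arr I (Term.idesc I)))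
    (hi : HasType Γ i I) : HasType Γ (app (Term.imu I R) i) (set 0) :=
  .app_arr (.imu hI hR) hi

theorem HasType.interp_app {R i X : Term} (hR : HasType Γ R (arr I (Term.idesc I)))
    (hi : HasType Γ i I) (hX : HasType Γ X (arr I (set 0))) :
    HasType Γ (Term.interp I (app R i) X) (set 0) :=
  .interp hI (.app_arr hR hi) hX

theorem HasType.inn {R i xs : Term} (hR : HasType Γ R (arr I (Term.idesc I)))
    (hi : HasType Γ i I) (hxs : HasType Γ xs (Term.interp I (app R i) (Term.imu I R))) :
    HasType Γ (inn I R i xs) (app (Term.imu I R) i) :=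
  .app_subst (.app_subst (.app_subst (.app_subst (.const_subst .inn hI.ctx_valid) hI) hR) hi) hxs

theorem HasType.iall {k : ℕ} {D X xs P : Term} (hD : HasType Γ D (Term.idesc I))
    (hX : HasType Γ X (arr I (set 0))) (hxs : HasType Γ xs (Term.interp I D X))
    (hP : HasType Γ P (arr (sig I (app X.wk (var 0))) (set k))) :
    HasType Γ (iall k I D X xs P) (set k) :=
  .app_subst (.app_subst (.app_subst (.app_subst (.app_subst
    (.const_subst (.iall k) hI.ctx_valid) hI) hD) hX) hxs) hP

end constants

theorem constType_hasType {Γ : Ctx} (c : Const) (h : Der (.valid Γ)) :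
    ∃ k, HasType Γ (constType c) (set k) := by
  cases c with
  | unit => exact ⟨_, .set 0 h⟩
  | void => exact ⟨_, .unit h⟩
  | uid => exact ⟨_, .set 0 h⟩
  | tag t => exact ⟨_, .uid h⟩
  | enumU => exact ⟨_, .set 0 h⟩
  | nilE => exact ⟨_, .enumU h⟩
  | consE => exact ⟨_, .arr_max (.uid h) (.arr_max (.enumU h) (.enumU h))⟩
  | enumT => exact ⟨_, .arr_max (.enumU h) (.set 0 h)⟩
  | zeroE => exact ⟨_, .pi_max (.uid h) fun h => .pi_max (.enumU h) fun h =>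
      .enumT (.consE (.var' h 1 rfl rfl) (.var' h 0 rfl rfl))⟩
  | sucE => exact ⟨_, .pi_max (.uid h) fun h => .pi_max (.enumU h) fun h =>
      .arr_max (.enumT (.var' h 0 rfl rfl))
        (.enumT (.consE (.var' h 1 rfl rfl) (.var' h 0 rfl rfl)))⟩
  | spi k => exact ⟨_, .pi_max (.enumU h) fun h =>
      .arr_max (.arr_max (.enumT (.var' h 0 rfl rfl)) (.set k h)) (.set k h)⟩
  | enumElim k => exact ⟨_, .pi_max (.enumU h) fun h =>
      .pi_max (.arr_max (.enumT (.var' h 0 rfl rfl)) (.set k h)) fun h =>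
      .arr_max (.spi (.var' h 1 rfl rfl) (.var' h 0 rfl rfl))
        (.pi_max (.enumT (.var' h 1 rfl rfl)) fun h =>
          .app_arr (A := Term.enumT (var 2)) (B := set k) (.var' h 1 rfl rfl) (.var' h 0 rfl rfl))⟩
  | eq k => exact ⟨_, .pi_max (.set k h) fun h => .arr_max (.var' h 0 rfl rfl)
      (.arr_max (.var' h 0 rfl rfl) (.set 0 h))⟩
  | refl k => exact ⟨_, .pi_max (.set k h) fun h => .pi_max (k := 0) (.var' h 0 rfl rfl) fun h =>
      .eq (.var' h 1 rfl rfl) (.var' h 0 rfl rfl) (.var' h 0 rfl rfl)⟩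
  | eqElim k j => exact ⟨_, .pi_max (.set k h) fun h => .pi_max (.var' h 0 rfl rfl) fun h =>
      .pi_max (.pi_max (.var' h 1 rfl rfl) fun h =>
        .arr_max (.eq (.var' h 2 rfl rfl) (.var' h 1 rfl rfl) (.var' h 0 rfl rfl)) (.set j h))
      fun h => .arr_max
        (.app_arr (A := Term.eq k (var 2) (var 1) (var 1)) (B := set j)
          (HasType.app_pi (A := var 2) (B := arr (Term.eq k (var 3) (var 2) (var 0)) (set j))
            (.var' h 0 rfl rfl) (.var' h 1 rfl rfl))
          (.refl (.var' h 2 rfl rfl) (.var' h 1 rfl rfl)))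
        (.pi_max (.var' h 2 rfl rfl) fun h => .pi_max
          (.eq (.var' h 3 rfl rfl) (.var' h 2 rfl rfl) (.var' h 0 rfl rfl)) fun h =>
            .app_arr (A := Term.eq k (var 4) (var 3) (var 1)) (B := set j)
              (HasType.app_pi (A := var 4) (B := arr (Term.eq k (var 5) (var 4) (var 0)) (set j))
                (.var' h 2 rfl rfl) (.var' h 1 rfl rfl))
              (.var' h 0 rfl rfl))⟩
  | idesc => exact ⟨_, .arr_max (.set 1 h) (.set 1 h)⟩
  | dvar => exact ⟨_, .pi_max (.set 1 h) fun h => .arr_max (.var' h 0 rfl rfl)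
      (.idesc (.var' h 0 rfl rfl))⟩
  | dunit => exact ⟨_, .pi_max (.set 1 h) fun h => .idesc (.var' h 0 rfl rfl)⟩
  | dtimes => exact ⟨_, .pi_max (.set 1 h) fun h => .arr_max (.idesc (.var' h 0 rfl rfl))
      (.arr_max (.idesc (.var' h 0 rfl rfl)) (.idesc (.var' h 0 rfl rfl)))⟩
  | dpi => exact ⟨_, .pi_max (.set 1 h) fun h => .pi_max (.set 0 h) fun h => .arr_max
      (.arr_max (.var' h 0 rfl rfl) (.idesc (.var' h 1 rfl rfl))) (.idesc (.var' h 1 rfl rfl))⟩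
  | dsigma => exact ⟨_, .pi_max (.set 1 h) fun h => .pi_max (.set 0 h) fun h => .arr_max
      (.arr_max (.var' h 0 rfl rfl) (.idesc (.var' h 1 rfl rfl))) (.idesc (.var' h 1 rfl rfl))⟩
  | denum => exact ⟨_, .pi_max (.set 1 h) fun h => .pi_max (.enumU h) fun h => .arr_max
      (.arr_max (.enumT (.var' h 0 rfl rfl)) (.idesc (.var' h 1 rfl rfl)))
      (.idesc (.var' h 1 rfl rfl))⟩
  | interp => exact ⟨_, .pi_max (.set 1 h) fun h => .arr_max (.idesc (.var' h 0 rfl rfl))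
      (.arr_max (.arr_max (.var' h 0 rfl rfl) (.set 0 h)) (.set 0 h))⟩
  | imu => exact ⟨_, .pi_max (.set 1 h) fun h =>
      .arr_max (.arr_max (.var' h 0 rfl rfl) (.idesc (.var' h 0 rfl rfl)))
        (.arr_max (.var' h 0 rfl rfl) (.set 0 h))⟩
  | inn => exact ⟨_, .pi_max (.set 1 h) fun h =>
      .pi_max (.arr_max (.var' h 0 rfl rfl) (.idesc (.var' h 0 rfl rfl))) fun h =>
      .pi_max (.var' h 1 rfl rfl) fun h => .arr_max
        (.interp_app (.var' h 2 rfl rfl) (.var' h 1 rfl rfl) (.var' h 0 rfl rfl)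
          (.imu (.var' h 2 rfl rfl) (.var' h 1 rfl rfl)))
        (.imu_app (.var' h 2 rfl rfl) (.var' h 1 rfl rfl) (.var' h 0 rfl rfl))⟩
  | iall k => exact ⟨_, .pi_max (.set 1 h) fun h => .pi_max (.idesc (.var' h 0 rfl rfl)) fun h =>
      .pi_max (.arr_max (.var' h 1 rfl rfl) (.set 0 h)) fun h =>
      .pi_max (.interp (.var' h 2 rfl rfl) (.var' h 1 rfl rfl) (.var' h 0 rfl rfl)) fun h =>
      .arr_max (.arr_max (.sig_max (j := 1) (k := 0) (.var' h 3 rfl rfl)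
        (.app_arr (A := var 4) (B := set 0)
          (.var' (HasType.valid_decl (k := 1) (.var' h 3 rfl rfl)) 2 rfl rfl)
          (.var' (HasType.valid_decl (k := 1) (.var' h 3 rfl rfl)) 0 rfl rfl)))
        (.set k h)) (.set k h)⟩
  | iallMap k => exact ⟨_, .pi_max (.set 1 h) fun h => .pi_max (.idesc (.var' h 0 rfl rfl)) fun h =>
      .pi_max (.arr_max (.var' h 1 rfl rfl) (.set 0 h)) fun h =>
      .pi_max (.arr_max (.sig_max (j := 1) (k := 0) (.var' h 2 rfl rfl)
        (.app_arr (A := var 3) (B := set 0)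
          (.var' (HasType.valid_decl (k := 1) (.var' h 2 rfl rfl)) 1 rfl rfl)
          (.var' (HasType.valid_decl (k := 1) (.var' h 2 rfl rfl)) 0 rfl rfl)))
        (.set k h)) fun h =>
      .arr_max (.pi_max (j := 1) (.var' h 3 rfl rfl) fun h => .pi_max
        (.app_arr (A := var 4) (B := set 0) (.var' h 2 rfl rfl) (.var' h 0 rfl rfl)) fun h =>
        .app_arr (A := sig (var 5) (app (var 4) (var 0))) (B := set k) (.var' h 2 rfl rfl)
          (HasType.pair_sig (k := 0) (.var' h 1 rfl rfl) (.app_arr (A := var 6) (B := set 0)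
            (.var' (HasType.valid_decl (k := 1) (.var' h 5 rfl rfl)) 4 rfl rfl)
            (.var' (HasType.valid_decl (k := 1) (.var' h 5 rfl rfl)) 0 rfl rfl))
            (.var' h 0 rfl rfl)))
        (.pi_max (.interp (.var' h 3 rfl rfl) (.var' h 2 rfl rfl) (.var' h 1 rfl rfl)) fun h =>
          .iall (.var' h 4 rfl rfl) (.var' h 3 rfl rfl) (.var' h 2 rfl rfl) (.var' h 0 rfl rfl)
            (.var' h 1 rfl rfl))⟩
  | iind k =>
    -- The family `IMu R` over the index type recurs at different depths, as domain of the motive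
    -- and as annotation of pairs; `n` and `R` locate the index type and the functional.
    have motive {Γ : Ctx} (R n : ℕ) (h : Der (.valid Γ)) (hn : HasType Γ (var n) (set 1))
        (hR : HasType Γ (var R) (arr (var n) (Term.idesc (var n)))) :
        HasType (.decl (var n) :: Γ) (app (Term.imu (var (n + 1)) (var (R + 1))) (var 0))
          (set 0) :=
      have h' := HasType.valid_decl hn
      .imu_app (HasType.wk hn h') (HasType.wk hR h') (.var' h' 0 rfl rfl)
    exact ⟨_, .pi_max (.set 1 h) fun h =>
      .pi_max (.arr_max (.var' h 0 rfl rfl) (.idesc (.var' h 0 rfl rfl))) fun h =>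
      .pi_max (.arr_max (.sig_max (j := 1) (.var' h 1 rfl rfl)
        (motive 0 1 h (.var' h 1 rfl rfl) (.var' h 0 rfl rfl))) (.set k h)) fun h =>
      .arr_max
        (.pi_max (j := 1) (.var' h 2 rfl rfl) fun h => .pi_max
          (.interp_app (.var' h 3 rfl rfl) (.var' h 2 rfl rfl) (.var' h 0 rfl rfl)
            (.imu (.var' h 3 rfl rfl) (.var' h 2 rfl rfl))) fun h => .arr_max
          (.iall (.var' h 4 rfl rfl) (.app_arr (.var' h 3 rfl rfl) (.var' h 1 rfl rfl))
            (.imu (.var' h 4 rfl rfl) (.var' h 3 rfl rfl)) (.var' h 0 rfl rfl)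
            (.var' h 2 rfl rfl))
          (.app_arr (A := sig (var 4) (app (Term.imu (var 5) (var 4)) (var 0))) (B := set k)
            (.var' h 2 rfl rfl)
            (HasType.pair_sig (.var' h 1 rfl rfl) (motive 3 4 h (.var' h 4 rfl rfl) (.var' h 3 rfl rfl))
              (.inn (.var' h 4 rfl rfl) (.var' h 3 rfl rfl) (.var' h 1 rfl rfl)
                (.var' h 0 rfl rfl)))))
        (.pi_max (j := 1) (.var' h 2 rfl rfl) fun h => .pi_max
          (.imu_app (.var' h 3 rfl rfl) (.var' h 2 rfl rfl) (.var' h 0 rfl rfl)) fun h =>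
          .app_arr (A := sig (var 4) (app (Term.imu (var 5) (var 4)) (var 0))) (B := set k)
            (.var' h 2 rfl rfl)
            (HasType.pair_sig (.var' h 1 rfl rfl) (motive 3 4 h (.var' h 4 rfl rfl) (.var' h 3 rfl rfl))
              (.var' h 0 rfl rfl)))⟩

/-- Every type of a term is a type. -/
theorem HasType.regular {Γ : Ctx} {t T : Term} (h : HasType Γ t T) :
    ∃ k, HasType Γ T (set k) := by
  unfold HasType at h
  generalize hJ : Jdg.type Γ t T = J at h
  induction h generalizing Γ t T with
  | @var Γ n e hΓ hn =>
    cases hJ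
    clear * - hΓ hn
    -- The type of a variable is the type in its entry, weakened once for each entry from there on;
    -- the induction weakens one entry at a time.
    induction Γ generalizing n with
    | nil => simp at hn
    | cons e' Γ ih =>
      have hs (m : ℕ) (A : Term) : A.shift (m + 1) = (A.shift m).wk := by
        rw [wk_eq, shift_eq, shift_eq, subst_subst]; rfl
      cases n with
      | zero =>
        obtain rfl : e' = e := by simpa using hn
        obtain ⟨k, hk⟩ := hΓ.valid_head
        refine ⟨k, ?_⟩
        rw [hs, shift_eq]
        change HasType _ (e'.ty.subst var).wk _
        rw [subst_var]
        exact HasType.wk hk hΓ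
      | succ n =>
        obtain ⟨k, hk⟩ := ih hΓ.valid_tail (by simpa using hn)
        exact ⟨k, by rw [hs]; exact HasType.wk hk hΓ⟩
  | set k hΓ => cases hJ; exact ⟨_, .set _ hΓ⟩
  | const c hΓ => cases hJ; exact constType_hasType c hΓ
  | pi hA hB => cases hJ; exact ⟨_, .set _ hA.ctx_valid⟩
  | sig hA hB => cases hJ; exact ⟨_, .set _ hA.ctx_valid⟩
  | lam hA _ _ ih => cases hJ; exact ⟨_, .pi_max hA fun _ => (ih rfl).choose_spec⟩
  | app _ hs ih =>
    cases hJ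
    obtain ⟨k, hk⟩ := ih rfl
    exact ⟨k, HasType.inst (HasType.pi_inv hk).2 hs⟩
  | pair _ hB _ ih => cases hJ; exact ⟨_, .sig_max (ih rfl).choose_spec hB⟩
  | fst _ ih => cases hJ; exact ⟨_, (HasType.sig_inv (ih rfl).choose_spec).1⟩
  | snd ht ih =>
    cases hJ
    obtain ⟨k, hk⟩ := ih rfl
    exact ⟨k, HasType.inst (HasType.sig_inv hk).2 (.fst ht)⟩
  | desc hl => cases hJ; exact ⟨_, .set _ hl.ctx_valid⟩
  | ret hl => cases hJ; exact ⟨_, .desc hl⟩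
  | call hl => cases hJ; exact ⟨_, .idesc (tel_ty hl)⟩
  | cumul hA => cases hJ; exact ⟨_, .set _ hA.ctx_valid⟩
  | conv _ _ hB => cases hJ; exact ⟨_, hB⟩
  | _ => cases hJ

/-! # Equal substitutions -/

/-- The substitutions `σ` and `σ'` of the variables of `Γ` are judgmentally equal. -/
def EqSub (Δ : Ctx) (σ σ' : ℕ → Term) (Γ : Ctx) : Prop :=
  WfSub Δ σ Γ ∧ ∀ n e, Γ[n]? = some e →
    EqType Δ (σ n) (σ' n) (e.ty.subst fun m => σ (m + (n + 1)))

theorem EqSub.lift {Δ Γ : Ctx} {σ σ' : ℕ → Term} (h : EqSub Δ σ σ' Γ) {A : Term} {k : ℕ}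
    (hA : HasType Δ (A.subst σ) (set k)) :
    EqSub (.decl (A.subst σ) :: Δ) (liftS σ) (liftS σ') (.decl A :: Γ) := by
  have hl := wfSub_substClass.lift h.1 hA
  refine ⟨hl, ?_⟩
  rintro (_ | n) e hn
  · exact .eq_refl (hl.2 0 e hn).1
  · have := EqType.wk (h.2 n e (by simpa using hn)) hl.1
    rw [wk_eq (subst _ _), subst_subst] at this
    have hs : (fun m => liftS σ (m + (n + 1 + 1))) =
        fun m => (σ (m + (n + 1))).subst fun n => .var (n + 1) := funext fun m => wk_eq _
    rw [hs]
    exact this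

/-- Equality judgements carry no content here: in the conversion case the equality of types only has
to be transported along the first substitution. -/
def Jdg.Functional : Jdg → Prop
  | .type Γ t T => ∀ Δ σ σ', EqSub Δ σ σ' Γ → EqType Δ (t.subst σ) (t.subst σ') (T.subst σ)
  | .tel Γ l => ∀ Δ σ σ', EqSub Δ σ σ' Γ → Der (.telEq Δ (l.subst σ) (l.subst σ'))
  | _ => True

theorem Der.lift_eqSub {Γ Δ : Ctx} {A : Term} {σ σ'} (h : Der (.valid (.decl A :: Γ)))
    (hσ : EqSub Δ σ σ' Γ) :
    WfSub (.decl (A.subst σ) :: Δ) (liftS σ) (.decl A :: Γ) ∧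
    EqSub (.decl (A.subst σ) :: Δ) (liftS σ) (liftS σ') (.decl A :: Γ) :=
  let ⟨_, hk⟩ := h.valid_head
  ⟨wfSub_substClass.lift hσ.1 (HasType.subst hk hσ.1), hσ.lift (HasType.subst hk hσ.1)⟩

/-- Each typing rule has a matching congruence rule, whose typing premises concern the left-hand
side only. This is why just the first of two equal substitutions is required to be well typed. -/
theorem Der.functional {J : Jdg} (h : Der J) : J.Functional := by
  induction h with
  | var hΓ hn => intro Δ σ σ' h; rw [shift_subst]; exact h.2 _ _ hn
  | set k hΓ => exact fun Δ σ σ' h => .eq_refl (.set k h.1.1)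
  | const c hΓ =>
    intro Δ σ σ' h
    rw [constType_subst]
    exact .eq_refl (.const c h.1.1)
  | pi hA hB ihA ihB =>
    intro Δ σ σ' h
    exact .eq_pi (HasType.subst hA h.1) (ihA _ _ _ h) (ihB _ _ _ (hB.ctx_valid.lift_eqSub h).2)
  | lam hA ht ihA iht =>
    intro Δ σ σ' h
    exact .eq_lam (HasType.subst hA h.1) (ihA _ _ _ h) (iht _ _ _ (ht.ctx_valid.lift_eqSub h).2)
  | app hf hs ihf ihs =>
    intro Δ σ σ' h
    rw [inst_subst]
    exact .eq_app (ihf _ _ _ h) (ihs _ _ _ h)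
  | sig hA hB ihA ihB =>
    intro Δ σ σ' h
    exact .eq_sig (HasType.subst hA h.1) (ihA _ _ _ h) (ihB _ _ _ (hB.ctx_valid.lift_eqSub h).2)
  | pair hs hB ht ihs ihB iht =>
    intro Δ σ σ' h
    have hl := hB.ctx_valid.lift_eqSub h
    have := iht _ _ _ h
    rw [inst_subst] at this
    -- The pairing rule does not record the level of the domain. It is recovered from the context
    -- and may differ from that of the family, hence the maximum.
    obtain ⟨j, hj⟩ := hB.ctx_valid.valid_head
    exact .eq_pair (.cumul (HasType.subst hj h.1) (le_max_left _ _))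
      (.cumul (HasType.subst hB hl.1) (le_max_right _ _))
      (.eq_cumul (ihB _ _ _ hl.2) (le_max_right _ _)) (ihs _ _ _ h) this
  | fst _ ih => exact fun Δ σ σ' h => .eq_fst (ih _ _ _ h)
  | snd _ ih =>
    intro Δ σ σ' h
    rw [inst_subst]
    exact .eq_snd (ih _ _ _ h)
  | desc _ ih => exact fun Δ σ σ' h => .eq_desc (ih _ _ _ h)
  | ret hl _ _ _ ihE ihT =>
    intro Δ σ σ' h
    refine .eq_ret (tel_subst hl h.1) (ihE _ _ _ h) ?_
    simpa only [Term.subst, wk_subst_liftS, Label.ty_subst] using ihT _ _ _ h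
  | call _ _ ihl iht =>
    intro Δ σ σ' h
    simp only [Term.subst, ← Label.ty_subst]
    exact .eq_call (ihl _ _ _ h) (iht _ _ _ h)
  | cumul _ hk ih => exact fun Δ σ σ' h => .eq_cumul (ih _ _ _ h) hk
  | conv _ he hB ih =>
    exact fun Δ σ σ' h => .eq_conv (ih _ _ _ h) (EqType.subst he h.1) (HasType.subst hB h.1)
  | tel_name D => exact fun Δ σ σ' h => .telEq_name D h.1.1
  | tel_param _ _ _ ihl ihP ihp =>
    exact fun Δ σ σ' h => .telEq_param (ihl _ _ _ h) (ihP _ _ _ h) (ihp _ _ _ h)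
  | tel_index hl hF _ ihl ihF ihi =>
    intro Δ σ σ' h
    have hs := hF.ctx_valid.lift_eqSub h
    have hi := ihi _ _ _ h
    rw [inst_subst, ← Label.ix_subst] at hi
    refine .telEq_index (tel_subst hl h.1) (ihl _ _ _ h) ?_ ?_ hi <;> rw [Label.ty_subst]
    exacts [HasType.subst hF hs.1, ihF _ _ _ hs.2]
  | tel_constr t hl hF _ ihl ihF ihi =>
    intro Δ σ σ' h
    have hs := hF.ctx_valid.lift_eqSub h
    have hi := ihi _ _ _ h
    rw [inst_subst, ← Label.ix_subst] at hi
    refine .telEq_constr t (tel_subst hl h.1) (ihl _ _ _ h) ?_ ?_ hi <;> rw [Label.ty_subst]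
    exacts [HasType.subst hF hs.1, ihF _ _ _ hs.2]
  | _ => trivial

/-- Judgmentally equal substitutions have judgmentally equal results. -/
theorem HasType.subst_eq {Γ Δ : Ctx} {t T : Term} {σ σ'} (h : HasType Γ t T)
    (hσ : EqSub Δ σ σ' Γ) : EqType Δ (t.subst σ) (t.subst σ') (T.subst σ) :=
  h.functional Δ σ σ' hσ

/-! # Soundness of the type checker -/

theorem NCtx.Valid.tail {a : Name × Entry} {Γ : NCtx} (h : NCtx.Valid (a :: Γ)) : Γ.Valid :=
  ⟨(List.nodup_cons.mp h.1).2, h.2.valid_tail⟩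

theorem Bidir.valid {d : Dir} {Γ : NCtx} {e : ETerm} {t T : Term} (h : Bidir d Γ e t T) :
    Γ.Valid := by
  induction h with
  | lam _ ih => exact ih.tail
  | _ => assumption

/-- In checking mode the type is an input, so it must be known to be a type; in synthesis it is an
output and nothing is assumed. The disjunction puts both modes into one induction. -/
theorem Bidir.sound {d : Dir} {Γ : NCtx} {e : ETerm} {t T : Term} (h : Bidir d Γ e t T) :
    (d = .infer ∨ ∃ k, HasType Γ.core T (.set k)) → HasType Γ.core t T := by
  induction h with
  | @var Γ x n e hΓ hn =>
    exact fun _ => .var hΓ.2 (by rw [NCtx.core, List.getElem?_map, hn]; rfl)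
  | set k hΓ => exact fun _ => .set k hΓ.2
  | const c hΓ => exact fun _ => .const c hΓ.2
  | app _ _ ihf ihs =>
    intro _
    have hf := ihf (.inl rfl)
    obtain ⟨k, hk⟩ := hf.regular
    -- Regularity of the synthesized function type makes its domain a type against which the
    -- argument may be checked.
    exact .app hf (ihs (.inr ⟨k, hk.pi_inv.1⟩))
  | fst _ ih => exact fun _ => .fst (ih (.inl rfl))
  | snd _ ih => exact fun _ => .snd (ih (.inl rfl))
  | @ann Γ _ _ _ _ k hT _ ihT iht =>
    exact fun _ => iht (.inr ⟨k, ihT (.inr ⟨_, .set k hT.valid.2⟩)⟩)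
  | infer_conv _ he hB ih => exact fun _ => .conv (ih (.inl rfl)) he hB
  | switch _ ih => exact fun _ => ih (.inl rfl)
  | cumul _ hk ih => exact fun _ => .cumul (ih (.inl rfl)) hk
  | check_conv _ he hA hB ih => exact fun _ => .conv (ih (.inr ⟨_, hA⟩)) he hB
  | pi hA hB ihA ihB =>
    exact fun _ => .pi (ihA (.inr ⟨_, .set _ hA.valid.2⟩)) (ihB (.inr ⟨_, .set _ hB.valid.2⟩))
  | sig hA hB ihA ihB =>
    exact fun _ => .sig (ihA (.inr ⟨_, .set _ hA.valid.2⟩)) (ihB (.inr ⟨_, .set _ hB.valid.2⟩))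
  | lam _ ih =>
    rintro (h | ⟨k, hk⟩)
    · cases h
    · exact .lam hk.pi_inv.1 (ih (.inr ⟨k, hk.pi_inv.2⟩))
  | tnil hΓ => exact fun _ => .const .void hΓ.2
  | tcons _ _ iht ihts =>
    rintro (h | ⟨k, hk⟩)
    · cases h
    · have ht := iht (.inr ⟨k, hk.sig_inv.1⟩)
      exact .pair ht hk.sig_inv.2 (ihts (.inr ⟨k, HasType.inst hk.sig_inv.2 ht⟩))
  | enum_nil hΓ => exact fun _ => .const .nilE hΓ.2
  | @enum_cons Γ a _ _ h ih =>
    exact fun _ => .consE (.const (.tag a) h.valid.2) (ih (.inr ⟨_, .enumU h.valid.2⟩))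
  | cases hE hP _ ihE ihes =>
    intro _
    have hE' := ihE (.inr ⟨_, .enumU hE.valid.2⟩)
    exact .enumElim hE' hP (ihes (.inr ⟨_, .spi hE' hP⟩))
  | tag_uid a hΓ => exact fun _ => .const (.tag a) hΓ.2
  | tag_zero a hΓ hE => exact fun _ => .zeroE (.const (.tag a) hΓ.2) hE
  | tag_suc b hE _ ih =>
    exact fun _ => .sucE (.const (.tag b) hE.ctx_valid) hE (ih (.inr ⟨_, .enumT hE⟩))
  | inn hI hR hi _ ih =>
    exact fun _ => .inn hI hR hi (ih (.inr ⟨_, .interp_app hI hR hi (.imu hI hR)⟩))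
  | ctor _ _ ih => exact ih

theorem Check.sound {Γ : NCtx} {e : ETerm} {t T : Term} {k : ℕ} (h : Check Γ e t T)
    (hT : HasType Γ.core T (set k)) : HasType Γ.core t T :=
  Bidir.sound h (.inr ⟨k, hT⟩)

/-! # Telescopes -/

/-- Extend a context by a telescope, outermost first. -/
def Ctx.ext : Ctx → List Term → Ctx
  | Γ, [] => Γ
  | Γ, A :: As => Ctx.ext (.decl A :: Γ) As

/-- Equal lengths matter because `NCtx.extend` stops at the end of the shorter list. -/
theorem NCtx.core_extend {Γ : NCtx} {xs : List Name} {As : List Term}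
    (h : xs.length = As.length) : (Γ.extend xs As).core = Ctx.ext Γ.core As := by
  induction xs generalizing Γ As with
  | nil => cases As with
    | nil => rfl
    | cons => simp at h
  | cons x xs ih => cases As with
    | nil => simp at h
    | cons A As => exact ih (by simpa using h)

theorem HasType.piTel_inv {Γ : Ctx} {As : List Term} {B : Term} {k : ℕ}
    (h : HasType Γ (piTel As B) (set k)) : HasType (Ctx.ext Γ As) B (set k) := by
  induction As generalizing Γ with
  | nil => exact h
  | cons A As ih => exact ih (HasType.pi_inv h).2

theorem HasType.lamTel {Γ : Ctx} {As : List Term} {t B : Term} {k : ℕ}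
    (h : HasType Γ (piTel As B) (set k)) (ht : HasType (Ctx.ext Γ As) t B) :
    HasType Γ (lamTel As t) (piTel As B) := by
  induction As generalizing Γ with
  | nil => exact ht
  | cons A As ih => exact .lam (HasType.pi_inv h).1 (ih (HasType.pi_inv h).2 ht)

/-! # Finite families of descriptions -/

theorem enumOf_hasType {Γ : Ctx} {os : List (Term × Term)} (hΓ : Der (.valid Γ))
    (h : ∀ o ∈ os, HasType Γ o.1 uid) : HasType Γ (enumOf os) enumU := by
  induction os with
  | nil => exact .const .nilE hΓ
  | cons o os ih =>
    exact .consE (h o (by simp)) (ih fun o ho => h o (by simp [ho]))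

theorem descFam_wk (I E : Term) : (descFam I E).wk = descFam I.wk E.wk := by
  change lam _ ((Term.idesc I).wk.rename (liftR Nat.succ)) = _
  rw [wk_rename_liftR]
  rfl

theorem descFam_hasType {Γ : Ctx} {I E : Term} (hI : HasType Γ I (set 1))
    (hE : HasType Γ E enumU) : HasType Γ (descFam I E) (arr (enumT E) (set 1)) :=
  have hT := HasType.enumT hE
  .lam hT (HasType.wk (.idesc hI) hT.valid_decl)

theorem descFam_app {Γ : Ctx} {I E x : Term} (hI : HasType Γ I (set 1))
    (hE : HasType Γ E enumU) (hx : HasType Γ x (enumT E)) :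
    EqType Γ (app (descFam I E) x) (idesc I) (set 1) := by
  have hT := HasType.enumT hE
  have := Der.beta hT (HasType.wk (.idesc hI) hT.valid_decl) hx
  rwa [wk_inst] at this

theorem descFam_app_hasType {Γ : Ctx} {I E x : Term} (hI : HasType Γ I (set 1))
    (hE : HasType Γ E enumU) (hx : HasType Γ x (enumT E)) :
    HasType Γ (app (descFam I E) x) (set 1) := .app_arr (descFam_hasType hI hE) hx

theorem EqType.app_arr {Γ : Ctx} {A B f f' a a' : Term} (hf : EqType Γ f f' (arr A B))
    (ha : EqType Γ a a' A) : EqType Γ (app f a) (app f' a') B := by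
  simpa using Der.eq_app hf ha

/-- Unfolding the lookup-tuple type yields the family at zero and the family precomposed with
successor. For a constant family both reduce by β, the second under a binder, to the description
type and to the constant family over the shorter enumeration. -/
theorem spi_descFam_cons {Γ : Ctx} {I t E : Term} (hI : HasType Γ I (set 1))
    (ht : HasType Γ t uid) (hE : HasType Γ E enumU) :
    EqType Γ (sig (idesc I) (spi 1 E (descFam I E)).wk)
      (spi 1 (consE t E) (descFam I (consE t E))) (set 1) := by
  have hc := HasType.consE ht hE
  have hz := HasType.zeroE ht hE
  have hv := (HasType.enumT hE).valid_decl
  have hI' := HasType.wk hI hv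
  have hc' := HasType.wk hc hv
  have hs := HasType.sucE (HasType.wk ht hv) (HasType.wk hE hv) (.var' hv 0 rfl rfl)
  have hd := HasType.idesc hI
  have hQ := Der.lam (HasType.enumT hE) (descFam_app_hasType hI' hc' hs)
  have hQe : EqType Γ (descFam I E)
      (lam (enumT E) (app (descFam I (consE t E)).wk (sucE t.wk E.wk (var 0))))
      (arr (enumT E) (set 1)) := by
    rw [descFam_wk]
    exact .eq_lam (HasType.enumT hE) (.eq_refl (HasType.enumT hE)) (.eq_symm (descFam_app hI' hc' hs))
  have hspi : HasType Γ (app (const (.spi 1)) E) (arr (arr (enumT E) (set 1)) (set 1)) :=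
    .app_subst (.const_subst (.spi 1) hE.ctx_valid) hE
  have hX : EqType Γ (spi 1 E (descFam I E)) (spi 1 E
      (lam (enumT E) (app (descFam I (consE t E)).wk (sucE t.wk E.wk (var 0))))) (set 1) :=
    EqType.app_arr (.eq_refl hspi) hQe
  rw [← descFam_wk] at hQ
  refine .eq_trans (.eq_sig hd (.eq_symm (descFam_app hI hc hz)) (EqType.wk hX hd.valid_decl))
    (.eq_symm (.comp (.spi_cons 1 t E _) (HasType.spi hc (descFam_hasType hI hc)) ?_))
  have hz' := descFam_app_hasType hI hc hz
  exact .sig hz' (HasType.wk (.spi hE hQ) hz'.valid_decl)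

theorem codeTuple_hasType {Γ : Ctx} {I : Term} {os : List (Term × Term)}
    (hI : HasType Γ I (set 1)) (h : ∀ o ∈ os, HasType Γ o.1 uid ∧ HasType Γ o.2 (idesc I)) :
    HasType Γ (codeTuple I os) (spi 1 (enumOf os) (descFam I (enumOf os))) := by
  have hΓ := hI.ctx_valid
  induction os with
  | nil =>
    have hn : HasType Γ nilE enumU := .const .nilE hΓ
    have hs := HasType.spi hn (descFam_hasType hI hn)
    exact .conv (.const .void hΓ) (.eq_symm (.comp (.spi_nil 1 _) hs
      (.cumul (HasType.unit hΓ) (Nat.zero_le 1)))) hs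
  | cons o os ih =>
    have ho := h o (by simp)
    have hos : ∀ o ∈ os, _ := fun o' ho' => h o' (List.mem_cons_of_mem o ho')
    have hE := enumOf_hasType hΓ fun o ho => (hos o ho).1
    have hc := HasType.consE ho.1 hE
    have hX := HasType.spi hE (descFam_hasType hI hE)
    have hd := HasType.idesc hI
    refine .conv (.pair ho.2 (HasType.wk hX hd.valid_decl) ?_) (spi_descFam_cons hI ho.1 hE)
      (HasType.spi hc (descFam_hasType hI hc))
    rw [wk_inst]
    exact ih hos

/-- The eliminator yields a dependent function into the constant family applied to its argument; β
under the binder makes the type non-dependent. -/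
theorem casesOf_hasType {Γ : Ctx} {I : Term} {os : List (Term × Term)}
    (hI : HasType Γ I (set 1)) (h : ∀ o ∈ os, HasType Γ o.1 uid ∧ HasType Γ o.2 (idesc I)) :
    HasType Γ (casesOf I os) (arr (enumT (enumOf os)) (idesc I)) := by
  have hE := enumOf_hasType hI.ctx_valid fun o ho => (h o ho).1
  have hT := Der.cumul (HasType.enumT hE) (Nat.zero_le 1)
  have hv := HasType.valid_decl hT
  have hx : HasType (.decl (enumT (enumOf os)) :: Γ) (var 0) (enumT (enumOf os).wk) :=
    .var' hv 0 rfl rfl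
  refine .conv (HasType.enumElim hE (descFam_hasType hI hE) (codeTuple_hasType hI h))
    (.eq_pi hT (.eq_refl hT) ?_) (HasType.arr_max hT (.idesc hI))
  rw [descFam_wk]
  exact descFam_app (HasType.wk hI hv) (HasType.wk hE hv) hx

/-! # Soundness of the elaboration of pattern choices -/

/-- The families in a label are typed over the whole product of preceding index types, so they can
be instantiated at the user's tuple in place of the label's own indices. -/
theorem ElabRecArgs.sound {Γ : NCtx} {l : Label} {T : ETerm} {is : Term}
    (h : ElabRecArgs Γ l T is) (hl : Der (.tel Γ.core l)) : HasType Γ.core is l.ty := by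
  induction h with
  | name D hΓ => exact .const .void hΓ.2
  | param _ _ ih =>
    cases hl with
    | tel_param hl => exact ih hl
  | index _ hi ih =>
    cases hl with
    | tel_index hl hF => exact .pair (ih hl) hF (hi.sound (HasType.inst hF (ih hl)))
  | constr _ hi ih =>
    cases hl with
    | tel_constr _ hl hF => exact .pair (ih hl) hF (hi.sound (HasType.inst hF (ih hl)))

/-- An equality type lies in `set 0` whatever the level of its carrier, so it may serve as the
domain of a Σ-code. The index type `J` stays fixed while the label is consumed. -/
theorem ElabEqs.sound {Γ : NCtx} {J q : Term} {l : Label} (h : ElabEqs Γ J l q)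
    (hJ : HasType Γ.core J (set 1)) : HasType Γ.core q (idesc J) := by
  induction h with
  | name => exact .dunit hJ
  | param _ ih => exact ih
  | index _ ih => exact ih
  | constr _ hn hA ht ih =>
    have he := HasType.eq hA (.var hJ.ctx_valid hn) (ht.sound hA)
    exact .dsigma hJ he (.lam he (HasType.wk (ih) he.valid_decl))

theorem ElabArgs.sound {Γ : NCtx} {l : Label} {args : Args} {c : Term}
    (h : ElabArgs Γ l args c) (hl : Der (.tel Γ.core l)) : HasType Γ.core c (idesc l.ty) := by
  induction h with
  | arg hT _ ih =>
    have hT' := hT.sound (.set 0 hl.ctx_valid)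
    have hc := ih (tel_wk hl hT'.valid_decl)
    rw [Label.ty_wk] at hc
    exact .dsigma (tel_ty hl) hT' (.lam hT' hc)
  | recur hi _ ih => exact .dtimes (tel_ty hl) (.dvar (tel_ty hl) (hi.sound hl)) (ih hl)
  | fn hT _ _ ih ihd =>
    have hT' := hT.sound (.set 0 hl.ctx_valid)
    have hc := ih (tel_wk hl hT'.valid_decl)
    rw [Label.ty_wk] at hc
    exact .dtimes (tel_ty hl) (.dpi (tel_ty hl) hT' (.lam hT' hc)) (ihd hl)
  | nil hq => exact hq.sound (tel_ty hl)

/-- Constraining an index only adds an external right-hand side; type family and value are kept. The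
two equalities let each well-formedness premise be reused verbatim over the new label. -/
theorem ElabIndices.sound {Γ : NCtx} {l l' : Label} {pt : Pat} (h : ElabIndices Γ l pt l') :
    l'.ty = l.ty ∧ l'.ix = l.ix ∧ (Der (.tel Γ.core l) → Der (.tel Γ.core l')) := by
  induction h with
  | name => exact ⟨rfl, rfl, id⟩
  | param _ _ ih =>
    refine ⟨ih.1, ih.2.1, fun h => ?_⟩
    cases h with
    | tel_param hl hP hp => exact .tel_param (ih.2.2 hl) hP hp
  | index _ _ ih =>
    refine ⟨by simp [Label.ty, ih.1], by simp [Label.ix, ih.2.1], fun h => ?_⟩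
    cases h with
    | tel_index hl hF hi => exact .tel_index (ih.2.2 hl) (by rwa [ih.1]) (by rwa [ih.2.1])
  | constr _ _ ih =>
    refine ⟨by simp [Label.ty, ih.1], by simp [Label.ix, ih.2.1], fun h => ?_⟩
    cases h with
    | tel_index hl hF hi => exact .tel_constr _ (ih.2.2 hl) (by rwa [ih.1]) (by rwa [ih.2.1])
  | constr_again _ _ ih =>
    refine ⟨by simp [Label.ty, ih.1], by simp [Label.ix, ih.2.1], fun h => ?_⟩
    cases h with
    | tel_constr _ hl hF hi => exact .tel_constr _ (ih.2.2 hl) (by rwa [ih.1]) (by rwa [ih.2.1])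

theorem ElabChoices.sound {Γ : NCtx} {l : Label} {cs : List Constr} {out : List (Term × Term)}
    (h : ElabChoices Γ l cs out) (hl : Der (.tel Γ.core l)) :
    ∀ o ∈ out, HasType Γ.core o.1 uid ∧ HasType Γ.core o.2 (idesc l.ty) := by
  unfold ElabChoices at h
  induction h with
  | nil => simp
  | cons hc _ ih =>
    obtain ⟨ht, ha⟩ := hc
    simp only [List.forall_mem_cons]
    exact ⟨⟨ht.sound (.uid hl.ctx_valid), ha.sound hl⟩, ih⟩

theorem ElabClauses.sound {Γ : NCtx} {l : Label} {cs : List (Pat × List Constr)}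
    {outs : List (Term × Term)} (h : ElabClauses Γ l cs outs) (hl : Der (.tel Γ.core l)) :
    ∀ o ∈ outs, HasType Γ.core o.1 uid ∧ HasType Γ.core o.2 (idesc l.ty) := by
  induction h with
  | nil => simp
  | cons hi hc _ ih =>
    intro o ho
    rcases List.mem_append.mp ho with ho | ho
    · rw [← hi.sound.1]
      exact hc.sound (hi.sound.2.2 hl) o ho
    · exact ih o ho

/-- Soundness of elimination gives a typing of `e` only. By regularity its type is a type, and
inverting the telescopes in it shows that the branch labels are well formed, which is what the
hypothesis on the branch codes asks for. -/
theorem elim_apps_hasType {Γ : Ctx} {l : Label} {bs : List Branch} {e : Term}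
    (he : HasType Γ e (elimTy bs l))
    (hbs : ∀ b ∈ bs, Der (.tel (Ctx.ext Γ b.tel) b.label) →
      HasType (Ctx.ext Γ b.tel) b.code (.desc b.label)) :
    HasType Γ (apps e (bs.map fun b => lamTel b.tel b.code)) (.desc l) := by
  induction bs generalizing e with
  | nil => exact he
  | cons b bs ih =>
    obtain ⟨k, hk⟩ := HasType.regular he
    have hb := (HasType.pi_inv hk).1
    exact ih (.app_arr he (.lamTel hb (hbs b (by simp) hb.piTel_inv.desc_inv)))
      fun b' hb' => hbs b' (by simp [hb'])

theorem ElabPatts.sound {EWM : NCtx → ETerm → Term → Term → Prop}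
    (hEWM : ∀ (Γ : NCtx) (e : ETerm) (e' T : Term), EWM Γ e e' T → HasType Γ.core e' T)
    {Γ : NCtx} {l : Label} {p : Patts} {c : Term} (h : ElabPatts EWM Γ l p c)
    (hl : Der (.tel Γ.core l)) : HasType Γ.core c (.desc l) := by
  have ret {Γ : Ctx} {l : Label} {os : List (Term × Term)} (hl : Der (.tel Γ l))
      (hos : ∀ o ∈ os, HasType Γ o.1 uid ∧ HasType Γ o.2 (idesc l.ty)) :
      HasType Γ (.ret (enumOf os) (casesOf l.ty os)) (.desc l) :=
    .ret hl (enumOf_hasType hl.ctx_valid fun o ho => (hos o ho).1)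
      (casesOf_hasType (tel_ty hl) hos)
  induction h with
  | clauses hcs => exact ret hl (hcs.sound hl)
  | elimBy bs hcs hpt he hlen _ hos ih =>
    subst hos
    refine ret hl fun o ho => ?_
    rcases List.mem_append.mp ho with ho | ho
    · exact hcs.sound hl o ho
    · obtain rfl := List.mem_singleton.mp ho
      refine ⟨.const _ hl.ctx_valid, ?_⟩
      -- The call stands at the label refined by the pattern, whose index type is that of the
      -- original one.
      rw [← hpt.sound.1]
      refine .call (hpt.sound.2.2 hl) (elim_apps_hasType (hEWM _ _ _ _ he) fun b hb hbl => ?_)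
      rw [← NCtx.core_extend (hlen b hb)] at hbl ⊢
      exact ih b hb hbl

-- Operations on equal substitutions

theorem EqSub.refl {Δ Γ : Ctx} {σ : ℕ → Term} (h : WfSub Δ σ Γ) : EqSub Δ σ σ Γ :=
  ⟨h, fun n e he => .eq_refl (h.2 n e he).1⟩

/-- The second family of equations is typed under `σ'` and has to be converted to types under `σ`;
functionality applied to the types in `Γ` does this, and validity of `Γ` makes them types. -/
theorem EqSub.trans {Δ Γ : Ctx} {σ σ' σ'' : ℕ → Term} (hΓ : Der (.valid Γ))
    (h : EqSub Δ σ σ' Γ) (h' : EqSub Δ σ' σ'' Γ) : EqSub Δ σ σ'' Γ := by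
  refine ⟨h.1, fun n e he => .eq_trans (h.2 n e he) ?_⟩
  obtain ⟨k, hk⟩ := HasType.regular (Der.var hΓ he)
  have h1 := hk.subst_eq h
  have h2 := HasType.subst hk h.1
  simp only [shift_subst] at h1 h2
  exact .eq_conv (h'.2 n e he) (.eq_symm h1) h2

theorem EqSub.wk {Δ Γ : Ctx} {σ σ' : ℕ → Term} (h : EqSub Δ σ σ' Γ) {e : Entry}
    (he : Der (.valid (e :: Δ))) :
    EqSub (e :: Δ) (fun n => (σ n).wk) (fun n => (σ' n).wk) Γ := by
  have hw : (fun n => (σ n).wk) = fun n => (σ n).subst fun m => .var (m + 1) :=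
    funext fun n => wk_eq _
  refine ⟨hw ▸ h.1.comp (.wk he), fun n e' he' => ?_⟩
  have := EqType.wk (h.2 n e' he') he
  rw [wk_eq (subst _ _), subst_subst] at this
  simp only [wk_eq] at this ⊢
  exact this

theorem EqSub.scons {Δ Γ : Ctx} {σ σ' : ℕ → Term} {s s' A : Term} (h : EqSub Δ σ σ' Γ)
    (hs : HasType Δ s (A.subst σ)) (hss' : EqType Δ s s' (A.subst σ)) :
    EqSub Δ (scons s σ) (scons s' σ') (.decl A :: Γ) := by
  refine ⟨h.1.scons hs, ?_⟩
  rintro (_ | n) e hn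
  · obtain rfl : Entry.decl A = e := by simpa using hn
    exact hss'
  · exact h.2 n e (by simpa using hn)

theorem WfSub.comp_eqSub {Γ Δ Θ : Ctx} {σ τ τ' : ℕ → Term} (hσ : WfSub Δ σ Γ)
    (hτ : EqSub Θ τ τ' Δ) : EqSub Θ (fun n => (σ n).subst τ) (fun n => (σ n).subst τ') Γ :=
  ⟨hσ.comp hτ.1, fun n e he => by
    simpa only [subst_subst] using (hσ.2 n e he).1.subst_eq hτ⟩

/-! # The definition of the datatype -/

theorem proj_subst (t : Term) (m : ℕ) (σ : ℕ → Term) :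
    (proj t m).subst σ = proj (t.subst σ) m := by
  induction m generalizing t with
  | zero => rfl
  | succ m ih => exact ih _

/-- The substitution that replaces the `n` innermost variables by the projections of a tuple,
which becomes the innermost variable. -/
def projSub (n m : ℕ) : Term := if m < n then proj (.var 0) m else .var (m - n + 1)

theorem projSub_subst_of_lt {n m : ℕ} (h : m < n) (t : Term) (σ : ℕ → Term) :
    (projSub n m).subst (scons t σ) = proj t m := by
  rw [projSub, if_pos h, proj_subst]; rfl

theorem projSub_subst_of_le {n m : ℕ} (h : n ≤ m) (t : Term) (σ : ℕ → Term) :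
    (projSub n m).subst (scons t σ) = σ (m - n) := by
  rw [projSub, if_neg (by omega)]; rfl

theorem projSub_succ (n : ℕ) :
    projSub (n + 1) = scons (.snd (.var 0))
      fun m => (projSub n m).subst (scons (.fst (.var 0)) fun k => .var (k + 1)) := by
  funext m
  cases m with
  | zero => simp [projSub, scons, proj]
  | succ m =>
    by_cases h : m < n
    · rw [projSub, if_pos (by omega)]
      simp [scons, projSub_subst_of_lt h, proj]
    · rw [projSub, if_neg (by omega)]
      simp [scons, projSub_subst_of_le (not_lt.mp h)]

/-- Tuples are nested to the left, so the newest index is the second projection and the older ones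
are read from the first. -/
theorem projSub_succ_subst (n : ℕ) (t : Term) (σ : ℕ → Term) :
    (fun m => (projSub (n + 1) m).subst (scons t σ)) =
      scons (.snd t) fun m => (projSub n m).subst (scons (.fst t) σ) := by
  funext m
  cases m with
  | zero => simp [projSub_succ, scons, Term.subst]
  | succ m =>
    by_cases h : m < n
    · rw [projSub_subst_of_lt (by omega)]
      simp [scons, projSub_subst_of_lt h, proj]
    · rw [projSub_subst_of_le (by omega)]
      simp [scons, projSub_subst_of_le (not_lt.mp h)]

/-- The family of an index in a label, from its family over the product of the preceding ones. -/
theorem indexFamily_eq (n : ℕ) (I : Term) :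
    ((I.subst fun m => if m < n then proj (.var 0) m else .var (m + 1)).rename (liftR Nat.succ)) =
      (I.subst (projSub n)).rename (liftR (· + (n + 1))) := by
  simp only [rename_eq_subst, subst_subst]
  congr 1
  funext m
  unfold projSub
  split
  · simp [proj_subst, Term.subst, liftR]
  · simp only [Term.subst, liftR, var.injEq]
    omega

theorem rename_liftR_inst (t s : Term) (ρ : ℕ → ℕ) :
    (t.rename (liftR ρ)).inst s = t.subst (scons s fun k => .var (ρ k)) := by
  rw [rename_eq_subst, ← liftS_var_comp, subst_liftS_inst]

/-- The label `l`, in the context `Γ'` which extends `Γ` by `n` variables, is well formed and its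
indices are these variables; `J` is the product of their types. -/
structure IndexedLabel (Γ : Ctx) (n : ℕ) (J : Term) (Γ' : Ctx) (l : Label) : Prop where
  prod : HasType Γ J (set 1)
  sub : WfSub (.decl J :: Γ) (projSub n) Γ'
  shift : WfSub Γ' (fun m => .var (m + n)) Γ
  tel : Der (.tel Γ' l)
  ty : l.ty = J.shift n
  proj_ix : EqSub Γ' (fun m => (projSub n m).subst (scons l.ix fun k => .var (k + n))) .var Γ'

theorem IndexedLabel.zero {Γ : Ctx} {l : Label} (hl : Der (.tel Γ l)) (hty : l.ty = unit) :
    IndexedLabel Γ 0 unit Γ l := by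
  have hu : HasType Γ unit (set 1) := hty ▸ tel_ty hl
  have hid := WfSub.id hl.ctx_valid
  exact ⟨hu, .wk hu.valid_decl, hid, hl, hty, .refl hid⟩

/-- Instantiating the new family at the old index tuple gives `I` under the projections of that
tuple. By `proj_ix` and functionality this is judgmentally the weakening of `I`, so the new variable
is an admissible index. -/
theorem IndexedLabel.succ {Γ Γ' : Ctx} {n : ℕ} {J I : Term} {l : Label}
    (h : IndexedLabel Γ n J Γ' l) (hI : HasType Γ' I (set 1)) :
    IndexedLabel Γ (n + 1) (.sig J (I.subst (projSub n))) (.decl I :: Γ')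
      (.index l.wk ((I.subst (projSub n)).rename (liftR (· + (n + 1)))) (.var 0)) := by
  have hv := hI.valid_decl
  have hF := HasType.subst hI h.sub
  have hJ' : HasType Γ (.sig J (I.subst (projSub n))) (set 1) := .sig h.prod hF
  have hv' := hJ'.valid_decl
  have h0 : HasType (.decl (.sig J (I.subst (projSub n))) :: Γ) (var 0)
      (.sig J.wk ((I.subst (projSub n)).rename (liftR Nat.succ))) := .var' hv' 0 rfl rfl
  have hsh : WfSub (.decl I :: Γ') (fun m => .var (m + (n + 1))) Γ := h.shift.comp (.wk hv)
  have hlw := tel_wk h.tel hv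
  have hlwty : l.wk.ty = J.subst fun m => .var (m + (n + 1)) := by
    rw [Label.ty_wk, h.ty, shift_eq, wk_eq, subst_subst]; rfl
  have hlix : HasType (.decl I :: Γ') l.wk.ix (J.subst fun m => .var (m + (n + 1))) :=
    hlwty ▸ tel_ix hlw
  have hF' : HasType (.decl l.wk.ty :: .decl I :: Γ')
      ((I.subst (projSub n)).rename (liftR (· + (n + 1)))) (set 1) := by
    rw [hlwty, rename_eq_subst, ← liftS_var_comp]
    exact HasType.subst hF (wfSub_substClass.lift hsh (HasType.subst h.prod hsh))
  have hinst (a : Term) : ((I.subst (projSub n)).rename (liftR (· + (n + 1)))).inst a =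
      I.subst fun m => (projSub n m).subst (scons a fun k => .var (k + (n + 1))) := by
    rw [rename_liftR_inst, subst_subst]
  have hwk : (fun m => ((projSub n m).subst (scons l.ix fun k => .var (k + n))).wk) =
      fun m => (projSub n m).subst (scons l.wk.ix fun k => .var (k + (n + 1))) := by
    funext m
    rw [wk_eq, subst_subst, Label.ix_wk]
    congr 1
    funext k
    cases k with
    | zero => exact (wk_eq _).symm
    | succ k => rfl
  have hvar : EqSub (.decl I :: Γ') _ (fun m => .var (m + 1)) Γ' := hwk ▸ h.proj_ix.wk hv
  have hi : HasType (.decl I :: Γ') (var 0)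
      (((I.subst (projSub n)).rename (liftR (· + (n + 1)))).inst l.wk.ix) := by
    rw [hinst]
    exact .conv (HasType.var' hv 0 rfl (wk_eq I)) (.eq_symm (hI.subst_eq hvar)) (HasType.subst hI hvar.1)
  have htel := Der.tel_index hlw hF' hi
  have hix := tel_ix htel
  have hfst := Der.fst_pair (tel_ix hlw) hF' hi
  have hsnd := Der.snd_pair (tel_ix hlw) hF' hi
  have hfst' := Der.fst hix
  have hsnd' := Der.snd hix
  rw [hlwty] at hfst hfst'
  rw [hinst] at hsnd hsnd'
  -- The first projection of the new tuple equals the old tuple, hence projecting older indices from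
  -- either gives equal substitutions.
  have hpre := h.sub.comp_eqSub ((EqSub.refl hsh).scons hfst' hfst)
  refine ⟨hJ', ?_, hsh, htel, ?_, ?_⟩
  · have h1 := Der.fst h0
    have h2 := Der.snd h0
    rw [wk_eq] at h1
    rw [rename_liftR_inst, subst_subst] at h2
    rw [projSub_succ]
    exact (h.sub.comp ((WfSub.wk hv').scons h1)).scons h2
  · rw [Label.ty, hlwty, ← shift_eq]
    rfl
  · rw [projSub_succ_subst]
    have hid : var = scons (var 0) fun m => var (m + 1) := by
      funext m; cases m <;> rfl
    rw [hid]
    -- The older indices pass through the old tuple to the variables. The equation for the newest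
    -- one is typed over the old tuple and is converted along `hpre` to the first projection of the
    -- new tuple.
    exact (hpre.trans h.tel.ctx_valid hvar).scons hsnd'
      (.eq_conv hsnd (.eq_symm (hI.subst_eq hpre)) (HasType.subst hI hpre.1))

theorem IndexedLabel.indexLabel {Γ Γ' : Ctx} {n : ℕ} {J B : Term} {Is : List Term} {l : Label}
    (h : IndexedLabel Γ n J Γ' l) (hIs : HasType Γ' (piTel Is B) (set 1)) :
    IndexedLabel Γ (n + Is.length) (indexProd n Is J) (Ctx.ext Γ' Is) (indexLabel n Is l) := by
  induction Is generalizing Γ' n J l with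
  | nil => exact h
  | cons I Is ih =>
    have := ih (h.succ (HasType.pi_inv hIs).1) (HasType.pi_inv hIs).2
    rw [← indexFamily_eq, Nat.add_right_comm] at this
    exact this

/-- Parameters contribute nothing to the index type, so the indices start from the empty product. -/
theorem paramLabel_wf {Γ : Ctx} {Ps : List Term} {B : Term} {k : ℕ} {l : Label}
    (hPs : HasType Γ (piTel Ps B) (set k)) (hl : Der (.tel Γ l)) (hty : l.ty = unit) :
    Der (.tel (Ctx.ext Γ Ps) (paramLabel Ps l)) ∧ (paramLabel Ps l).ty = unit := by
  induction Ps generalizing Γ l with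
  | nil => exact ⟨hl, hty⟩
  | cons P Ps ih =>
    obtain ⟨hP, hPs⟩ := HasType.pi_inv hPs
    have hv := HasType.valid_decl hP
    refine ih hPs (.tel_param (tel_wk hl hv) (HasType.wk hP hv) (HasType.var' hv 0 rfl rfl)) ?_
    rw [Label.ty, Label.ty_wk, hty]
    rfl

-- The uncurried functional and its fixpoint

theorem HasType.piTel_codomain {Γ : Ctx} {As : List Term} {B B' : Term} {k : ℕ}
    (h : HasType Γ (piTel As B) (set k)) (hB' : HasType (Ctx.ext Γ As) B' (set k)) :
    HasType Γ (piTel As B') (set k) := by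
  induction As generalizing Γ with
  | nil => exact hB'
  | cons A As ih => exact .pi (HasType.pi_inv h).1 (ih (HasType.pi_inv h).2 hB')

theorem Ctx.ext_getElem? (Γ : Ctx) (As : List Term) (k : ℕ) :
    (Ctx.ext Γ As)[k + As.length]? = Γ[k]? := by
  induction As generalizing Γ k with
  | nil => rfl
  | cons A As ih =>
    have := ih (.decl A :: Γ) (k + 1)
    rw [Nat.add_right_comm] at this
    exact this

/-- A function of a telescope of arguments, applied to the values of these variables. -/
theorem HasType.apps {Γ Δ : Ctx} {As : List Term} {f B : Term} {σ τ : ℕ → Term}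
    (hτ : WfSub Δ τ (Ctx.ext Γ As)) (hσ : ∀ m, τ (m + As.length) = σ m)
    (hf : HasType Δ f ((piTel As B).subst σ)) :
    HasType Δ (apps f ((List.range As.length).reverse.map τ)) (B.subst τ) := by
  induction As generalizing Γ f σ with
  | nil => rwa [show τ = σ from funext hσ]
  | cons A As ih =>
    have ha := (hτ.2 As.length (.decl A) (by
      have := Ctx.ext_getElem? (.decl A :: Γ) As 0
      rwa [Nat.zero_add] at this)).1
    have hA : (fun m => τ (m + (As.length + 1))) = σ := funext hσ
    rw [hA] at ha
    -- Arguments are supplied outermost first, so the first one is the image of the variable with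
    -- the largest index, `As.length`.
    rw [List.length_cons, List.range_succ, List.reverse_append]
    refine ih (σ := scons (τ As.length) σ) hτ ?_ (.app_subst hf ha)
    rintro (_ | m)
    · rw [Nat.zero_add]; rfl
    · exact (congrArg τ (by rw [List.length_cons]; omega)).trans (hσ m)

/-- Uncurrying is application of `f` to the images of the index variables under `projSub`. The
result type does not vary with the indices, since `l.ty` is a shift of `J` past them. -/
theorem IndexedLabel.uncurry_hasType {Γ : Ctx} {Is : List Term} {J f : Term} {l : Label}
    (h : IndexedLabel Γ Is.length J (Ctx.ext Γ Is) l)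
    (hf : HasType Γ f (piTel Is (idesc l.ty))) :
    HasType Γ (uncurry J Is.length f) (arr J (idesc J)) := by
  have hv := h.prod.valid_decl
  refine .lam h.prod ?_
  have hw := HasType.wk hf hv
  rw [wk_eq (piTel _ _)] at hw
  have := HasType.apps (σ := fun m => var (m + 1)) h.sub (fun m => by simp [projSub]) hw
  have hmap : (List.range Is.length).reverse.map (projSub Is.length) =
      (List.range Is.length).reverse.map (proj (var 0)) := by
    refine List.map_congr_left fun m hm => ?_
    rw [projSub, if_pos (by simpa using hm)]
  have hty : (idesc l.ty).subst (projSub Is.length) = (idesc J).wk := by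
    rw [h.ty]
    change app _ ((J.shift _).subst _) = app _ J.wk
    rw [shift_subst, wk_eq]
    simp [projSub, Term.subst, Term.rename]
  rwa [hmap, hty] at this

/-- Well-formedness of the label follows from the telescopes alone, so the code need only be typed
under that assumption. Replacing `set 0` by the description type in the index telescope is possible
because both lie in `set 1`. -/
theorem dataTerm_hasType {Γ : Ctx} {Ps Is : List Term} {D : Name} {code : Term}
    (h : HasType Γ (piTel (Ps ++ Is) (set 0)) (set 1))
    (hcode : Der (.tel (Ctx.ext (Ctx.ext Γ Ps) Is) (dataLabel D Ps Is)) →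
      HasType (Ctx.ext (Ctx.ext Γ Ps) Is) code (.desc (dataLabel D Ps Is))) :
    HasType Γ (dataTerm D Ps Is code) (piTel (Ps ++ Is) (set 0)) := by
  rw [piTel, List.foldr_append] at h ⊢
  have hIs : HasType (Ctx.ext Γ Ps) (piTel Is (set 0)) (set 1) := HasType.piTel_inv h
  obtain ⟨htel, hty⟩ := paramLabel_wf h (.tel_name D h.ctx_valid) rfl
  have hl : IndexedLabel (Ctx.ext Γ Ps) Is.length (indexProd 0 Is unit)
      (Ctx.ext (Ctx.ext Γ Ps) Is) (dataLabel D Ps Is) := by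
    have := (IndexedLabel.zero htel hty).indexLabel hIs
    rwa [Nat.zero_add] at this
  have hcall : HasType _ _ _ := Der.call hl.tel (hcode hl.tel)
  have hR := hl.uncurry_hasType
    (HasType.lamTel (HasType.piTel_codomain hIs (.idesc (tel_ty hl.tel))) hcall)
  -- Index type and functional are formed over the parameters only, and are weakened past the index
  -- variables to which the fixpoint is applied.
  have hJ' := HasType.subst hl.prod hl.shift
  have hR' := HasType.subst hR hl.shift
  simp only [Term.subst, wk_subst_liftS] at hR'
  refine HasType.lamTel h (HasType.lamTel hIs (HasType.imu_app ?_ ?_ ?_))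
  · rw [shift_eq]; exact hJ'
  · rw [shift_eq, shift_eq]; exact hR'
  · rw [← hl.ty]; exact tel_ix hl.tel

end IndFam

-- Soundness of the elaboration of definitions

theorem mainTheorem1
    (EWM : IndFam.NCtx → IndFam.ETerm → IndFam.Term → IndFam.Term → Prop)
    (hEWM : ∀ (Γ : IndFam.NCtx) (e : IndFam.ETerm) (e' T : IndFam.Term),
      EWM Γ e e' T → IndFam.HasType Γ.core e' T)
    (Γ : IndFam.NCtx) (D : IndFam.Name) (ps is : List (IndFam.Name × IndFam.ETerm))
    (choices : IndFam.Patts) (Δ : IndFam.NCtx)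
    (h : IndFam.ElabIData EWM Γ D ps is choices Δ) :
    Δ.Valid := by
  obtain @⟨Ps, Is, code, hD, hPs, hIs, hty, hcode⟩ := h
  have hΓ := hty.valid
  have hty' := IndFam.Check.sound hty (.set 1 hΓ.2)
  have hcore : ((Γ.extend (ps.map Prod.fst) Ps).extend (is.map Prod.fst) Is).core =
      IndFam.Ctx.ext (IndFam.Ctx.ext Γ.core Ps) Is := by
    rw [IndFam.NCtx.core_extend (by simp [hIs]), IndFam.NCtx.core_extend (by simp [hPs])]
  have hdata : IndFam.HasType Γ.core (IndFam.dataTerm D Ps Is code)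
      (IndFam.piTel (Ps ++ Is) (.set 0)) :=
    IndFam.dataTerm_hasType hty' fun hl => by
      rw [← hcore] at hl ⊢
      exact hcode.sound hEWM hl
  exact ⟨List.nodup_cons.mpr ⟨hD, hΓ.1⟩, .valid_defn hΓ.2 hty' hdata⟩
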